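/- Work in a model $\mathcal E$ of extensional type theory, i.e. a locally cartesian closed category with finite limits and finite coproducts. A \emph{universe} is a morphism $p : El \to Ty$; it is \emph{generic} for the class of its pullbacks, called the $U$-small families; a \emph{map of universes} is a cartesian square between them. \emph{Codes} on a universe are operations on $Ty$, stable under substitution, for dependent products, dependent sums, equality types, the unit type and the booleans; the universe with these codes is a \emph{weak Tarski universe} if the codes decode to the respective types up to isomorphism. Let $U_0 : U_1 : \dots : U_\omega$ be a weakly cumulative hierarchy of weak Tarski universes: for all $i<j\le\omega$ the object $Ty_i$ is $U_j$-small, and there is a map of universes $U_i \to U_j$ (the lifts need not commute with codes or with each other). Suppose that $U_\omega$ supports large induction-recursion: for every type $D$, every inductive-recursive definition of a type $X$ and a function $X \to D$ by finitely many constructors, with argument types coded in $U_\omega$, has a solution (an initial interpretation of its introduction rules and defining equations) with $X$ being $U_\omega$-small. Then there are universes $V_0 : V_1 : \dots$ with decoding maps of universes $\mathrm{dec}_i : V_i \to U_\omega$ such that 1. each $V_i$ has codes for dependent products, dependent sums, equality types, unit and booleans; those for products, sums and equality types are injective operations, and $\mathrm{dec}_i$ sends each code to the corresponding code of $U_\omega$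 on the nose; 2. there are a code $v_k$ of the type $V_k$ in $U_\omega$ and, for all $k<i$, a code $\mathrm{uni}_k$ in $V_i$ with $\mathrm{dec}_i(\mathrm{uni}_k) = v_k$; 3. the hierarchy is strictly cumulative: there are maps of universes $V_i \to V_j$ for $i\le j$, strictly functorial, commuting strictly with decoding and with all the codes, including the $\mathrm{uni}_k$; 4. there are maps of universes $\mathrm{up}_i : U_i \to V_i$ whose composite with $\mathrm{dec}_i$ is the given lift $U_i \to U_\omega$; in particular every $U_i$-small family is $V_i$-small; 5. $V_i$ is generic for the same class of families as $U_i$ whenever the types $V_k$, $k<i$, are $U_i$-small. If every $U_{i+1}$ supports small induction-recursion (inductive-recursive definitions of $X$ in $U_{i+1}$ and $X\to Ty_i$), then $V_i$ is generic for the same class of families as $U_i$ for every $i$. -/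

import Mathlib

open CategoryTheory CategoryTheory.Limits

universe v u

namespace TarskiUniverse

/-- A category with pullbacks is locally cartesian closed when every pullback functor
`Over Y ⥤ Over X` has a right adjoint (the dependent product). Locally cartesian closed categories
with finite limits and finite coproducts are the models of extensional type theory used here:
objects are contexts, a type over `Γ` is a morphism into `Γ`, and a term of `X ⟶ Γ` is a section
of it. -/
class LCCC (E : Type u) [Category.{v} E] [HasPullbacks E] : Prop where
  isLeftAdjoint : ∀ {X Y : E} (f : X ⟶ Y), (Over.pullback f).IsLeftAdjoint

attribute [instance] LCCC.isLeftAdjoint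

/-- The data of a universe à la Tarski: an object `Ty` of codes and the family `p : El ⟶ Ty` of
the types that are decoded from them. -/
structure Univ (E : Type u) [Category.{v} E] where
  Ty : E
  El : E
  p : El ⟶ Ty

section Basic

variable {E : Type u} [Category.{v} E]

namespace Univ

variable (U : Univ E)

/-- The code `a`, in context `Γ`, decodes (up to isomorphism over `Γ`) to the family `f`. -/
def Decodes {X Γ : E} (a : Γ ⟶ U.Ty) (f : X ⟶ Γ) : Prop :=
  ∃ t : X ⟶ U.El, IsPullback t f U.p a

/-- The class of families for which `U.p` is generic: the pullbacks of `U.p`. -/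
def Small {X Γ : E} (f : X ⟶ Γ) : Prop :=
  ∃ a : Γ ⟶ U.Ty, U.Decodes a f

/-- Two universes are generic for the same class of families. -/
def SameClass (V : Univ E) : Prop :=
  ∀ ⦃X Γ : E⦄ (f : X ⟶ Γ), U.Small f ↔ V.Small f

/-- A map of universes: a map of codes together with an identification, up to isomorphism, of the
decoded families. This is what a lift from a universe to a larger one has to provide. -/
@[ext]
structure Hom (U W : Univ E) where
  ty : U.Ty ⟶ W.Ty
  el : U.El ⟶ W.El
  isPullback : IsPullback el U.p W.p ty

/-- The identity lift. -/
def Hom.id : Hom U U where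
  ty := 𝟙 _
  el := 𝟙 _
  isPullback := IsPullback.of_id_fst

variable {U}

/-- Composition of lifts. -/
def Hom.comp {V W : Univ E} (h : Hom U V) (k : Hom V W) : Hom U W where
  ty := h.ty ≫ k.ty
  el := h.el ≫ k.el
  isPullback := h.isPullback.paste_horiz k.isPullback

end Univ

end Basic

section Codes

variable {E : Type u} [Category.{v} E] [HasFiniteLimits E]

namespace Univ

variable (U : Univ E)

/-- The context `Γ, x : El a`. -/
noncomputable abbrev ext {Γ : E} (a : Γ ⟶ U.Ty) : E := pullback a U.p

/-- The context projection `Γ, x : El a ⟶ Γ`. -/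
noncomputable abbrev proj {Γ : E} (a : Γ ⟶ U.Ty) : U.ext a ⟶ Γ := pullback.fst a U.p

/-- The substitution `(Δ, x : El b) ⟶ (Γ, x : El a)` induced by `τ : Δ ⟶ Γ` if `b = a[τ]`. -/
noncomputable def extMap {Γ Δ : E} (τ : Δ ⟶ Γ) {a : Γ ⟶ U.Ty} {b : Δ ⟶ U.Ty} (h : b = τ ≫ a) :
    U.ext b ⟶ U.ext a :=
  pullback.lift (pullback.fst b U.p ≫ τ) (pullback.snd b U.p)
    (by rw [Category.assoc, ← h, pullback.condition])

/-- A code `A` in context `Γ` with a family of codes `B` in context `Γ, x : El A`. -/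
@[ext]
structure Fam (Γ : E) where
  dom : Γ ⟶ U.Ty
  cod : U.ext dom ⟶ U.Ty

/-- Two elements, in context `Γ`, of the same code. -/
@[ext]
structure Pair (Γ : E) where
  lhs : Γ ⟶ U.El
  rhs : Γ ⟶ U.El
  eq : lhs ≫ U.p = rhs ≫ U.p

variable {U}

/-- Substitution in a family of codes. -/
noncomputable def Fam.subst {Γ Δ : E} (τ : Δ ⟶ Γ) (x : U.Fam Γ) : U.Fam Δ where
  dom := τ ≫ x.dom
  cod := U.extMap τ rfl ≫ x.cod

/-- Substitution in a pair of elements. -/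
def Pair.subst {Γ Δ : E} (τ : Δ ⟶ Γ) (x : U.Pair Γ) : U.Pair Δ where
  lhs := τ ≫ x.lhs
  rhs := τ ≫ x.rhs
  eq := by rw [Category.assoc, Category.assoc, x.eq]

/-- For a map of universes `h`, the comparison `(Γ, x : El (h a)) ⟶ (Γ, x : El a)`. -/
noncomputable def Hom.extBack {W : Univ E} (h : Hom U W) {Γ : E} (a : Γ ⟶ U.Ty) :
    W.ext (a ≫ h.ty) ⟶ U.ext a :=
  pullback.lift (pullback.fst (a ≫ h.ty) W.p)
    (h.isPullback.lift (pullback.snd (a ≫ h.ty) W.p) (pullback.fst (a ≫ h.ty) W.p ≫ a)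
      (by rw [Category.assoc, pullback.condition]))
    (by rw [IsPullback.lift_snd])

/-- The action of a map of universes on families of codes. -/
noncomputable def Hom.fam {W : Univ E} (h : Hom U W) {Γ : E} (x : U.Fam Γ) : W.Fam Γ where
  dom := x.dom ≫ h.ty
  cod := h.extBack x.dom ≫ x.cod ≫ h.ty

/-- The action of a map of universes on pairs of elements. -/
def Hom.pair {W : Univ E} (h : Hom U W) {Γ : E} (x : U.Pair Γ) : W.Pair Γ where
  lhs := x.lhs ≫ h.el
  rhs := x.rhs ≫ h.el
  eq := by
    rw [Category.assoc, Category.assoc, h.isPullback.w, ← Category.assoc, x.eq, Category.assoc]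

variable (U)

/-- A choice, stable under substitution, of operations on codes: dependent products, dependent
sums, equality types, the unit type and the booleans. -/
structure Codes where
  pi : ∀ {Γ : E}, U.Fam Γ → (Γ ⟶ U.Ty)
  sigma : ∀ {Γ : E}, U.Fam Γ → (Γ ⟶ U.Ty)
  eq : ∀ {Γ : E}, U.Pair Γ → (Γ ⟶ U.Ty)
  unit : ⊤_ E ⟶ U.Ty
  bool : ⊤_ E ⟶ U.Ty
  pi_subst : ∀ {Γ Δ : E} (τ : Δ ⟶ Γ) (x : U.Fam Γ), τ ≫ pi x = pi (x.subst τ)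
  sigma_subst : ∀ {Γ Δ : E} (τ : Δ ⟶ Γ) (x : U.Fam Γ), τ ≫ sigma x = sigma (x.subst τ)
  eq_subst : ∀ {Γ Δ : E} (τ : Δ ⟶ Γ) (x : U.Pair Γ), τ ≫ eq x = eq (x.subst τ)

variable {U}

/-- The operations on codes decode, up to isomorphism, to the type formers that they are named
after. A universe with such codes is a weak universe à la Tarski. -/
structure Codes.IsWeak [HasFiniteCoproducts E] [LCCC E] (c : U.Codes) : Prop where
  pi : ∀ {Γ : E} (x : U.Fam Γ),
    U.Decodes (c.pi x)
      ((Over.pullback (U.proj x.dom)).rightAdjoint.obj (Over.mk (U.proj x.cod))).hom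
  sigma : ∀ {Γ : E} (x : U.Fam Γ), U.Decodes (c.sigma x) (U.proj x.cod ≫ U.proj x.dom)
  eq : ∀ {Γ : E} (x : U.Pair Γ), U.Decodes (c.eq x) (equalizer.ι x.lhs x.rhs)
  unit : U.Decodes c.unit (𝟙 (⊤_ E))
  bool : U.Decodes c.bool (terminal.from ((⊤_ E) ⨿ (⊤_ E)))

/-- The operations on codes are injective (on generalized elements, hence internally). -/
structure Codes.IsInjective (c : U.Codes) : Prop where
  pi : ∀ Γ : E, Function.Injective (c.pi : U.Fam Γ → (Γ ⟶ U.Ty))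
  sigma : ∀ Γ : E, Function.Injective (c.sigma : U.Fam Γ → (Γ ⟶ U.Ty))
  eq : ∀ Γ : E, Function.Injective (c.eq : U.Pair Γ → (Γ ⟶ U.Ty))

/-- A map of universes commutes strictly, that is up to equality of codes, with the operations on
codes. -/
structure Hom.IsStrict {W : Univ E} (h : Hom U W) (c : U.Codes) (d : W.Codes) : Prop where
  pi : ∀ {Γ : E} (x : U.Fam Γ), c.pi x ≫ h.ty = d.pi (h.fam x)
  sigma : ∀ {Γ : E} (x : U.Fam Γ), c.sigma x ≫ h.ty = d.sigma (h.fam x)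
  eq : ∀ {Γ : E} (x : U.Pair Γ), c.eq x ≫ h.ty = d.eq (h.pair x)
  unit : c.unit ≫ h.ty = d.unit
  bool : c.bool ≫ h.ty = d.bool

end Univ

end Codes

section InductionRecursion

variable {E : Type u} [Category.{v} E] [HasFiniteLimits E]

/-- The context `Γ, g : El a → D`, given by its universal property. -/
structure FunCtx (U : Univ E) (D : E) {Γ : E} (a : Γ ⟶ U.Ty) where
  obj : E
  proj : obj ⟶ Γ
  ev : U.ext (proj ≫ a) ⟶ D
  universal : ∀ {Δ : E} (γ : Δ ⟶ Γ) (g : U.ext (γ ≫ a) ⟶ D),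
    ∃! γ' : Δ ⟶ obj, ∃ h : γ' ≫ proj = γ,
      U.extMap γ' (by rw [← h, Category.assoc]) ≫ ev = g

/-- The shape of one constructor of an inductive-recursive definition of a type `X` together with a
function `T : X → D`; the argument types are codes of `U`, and `Γ` is the context of what the shape
may depend on:
* `iota d`: no more arguments, and `T` takes the value `d` on the constructed element;
* `sigma a c`: an ordinary argument of type `El a`, on which the rest `c` depends;
* `delta a F c`: an inductive argument `g : El a → X`; the rest `c` depends on `T ∘ g : El a → D`. -/
inductive IRCode (U : Univ E) (D : E) : E → Type (max u v)
  | iota {Γ : E} (d : Γ ⟶ D) : IRCode U D Γ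
  | sigma {Γ : E} (a : Γ ⟶ U.Ty) (c : IRCode U D (U.ext a)) : IRCode U D Γ
  | delta {Γ : E} (a : Γ ⟶ U.Ty) (F : FunCtx U D a) (c : IRCode U D F.obj) : IRCode U D Γ

namespace IRCode

variable {U : Univ E} {D : E}

/-- The arguments, in context `Δ`, of a constructor of shape `c` for `T : X → D`, over a value
`γ` of the context of `c`. -/
noncomputable def Arg {X : E} (T : X ⟶ D) {Δ : E} : {Γ : E} → IRCode U D Γ → (Δ ⟶ Γ) → Type v
  | _, iota _, _ => PUnit
  | _, sigma a c, γ => Σ γ' : {γ' : Δ ⟶ U.ext a // γ' ≫ U.proj a = γ}, Arg T c γ'.1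
  | _, delta a F c, γ =>
      Σ g : U.ext (γ ≫ a) ⟶ X,
        Σ γ' : {γ' : Δ ⟶ F.obj // ∃ h : γ' ≫ F.proj = γ,
          U.extMap γ' (by rw [← h, Category.assoc]) ≫ F.ev = g ≫ T}, Arg T c γ'.1

/-- The value that `T` takes on the element constructed from the given arguments. -/
noncomputable def val {X : E} (T : X ⟶ D) {Δ : E} :
    {Γ : E} → (c : IRCode U D Γ) → {γ : Δ ⟶ Γ} → Arg T c γ → (Δ ⟶ D)
  | _, iota d, γ, _ => γ ≫ d
  | _, sigma _ c, _, x => val T c x.2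
  | _, delta _ _ c, _, x => val T c x.2.2

theorem extMap_comp {Γ Δ Θ : E} (σ : Θ ⟶ Δ) (τ : Δ ⟶ Γ) {a : Γ ⟶ U.Ty} {b : Δ ⟶ U.Ty}
    {c : Θ ⟶ U.Ty} (h : b = τ ≫ a) (h' : c = σ ≫ b) (h'' : c = (σ ≫ τ) ≫ a) :
    U.extMap σ h' ≫ U.extMap τ h = U.extMap (σ ≫ τ) h'' := by
  unfold Univ.extMap
  apply pullback.hom_ext
  · rw [Category.assoc, pullback.lift_fst, pullback.lift_fst, pullback.lift_fst_assoc,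
      Category.assoc]
  · rw [Category.assoc, pullback.lift_snd, pullback.lift_snd, pullback.lift_snd]

theorem subst_aux {X : E} (T : X ⟶ D) {Γ Δ Δ' : E} (τ : Δ' ⟶ Δ) {a : Γ ⟶ U.Ty}
    (F : FunCtx U D a) {γ : Δ ⟶ Γ} (g : U.ext (γ ≫ a) ⟶ X) {γ' : Δ ⟶ F.obj}
    (H : ∃ h : γ' ≫ F.proj = γ,
      U.extMap γ' (by rw [← h, Category.assoc]) ≫ F.ev = g ≫ T) :
    ∃ h : (τ ≫ γ') ≫ F.proj = τ ≫ γ,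
      U.extMap (τ ≫ γ') (by rw [← h, Category.assoc]) ≫ F.ev =
        (U.extMap τ (Category.assoc τ γ a) ≫ g) ≫ T := by
  obtain ⟨h, e⟩ := H
  refine ⟨by rw [Category.assoc, h], ?_⟩
  rw [Category.assoc (U.extMap τ _) g T, ← e, ← Category.assoc (U.extMap τ _), extMap_comp]

/-- Substitution in the arguments of a constructor. -/
noncomputable def subst {X : E} (T : X ⟶ D) {Δ Δ' : E} (τ : Δ' ⟶ Δ) :
    {Γ : E} → (c : IRCode U D Γ) → {γ : Δ ⟶ Γ} → Arg T c γ → Arg T c (τ ≫ γ)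
  | _, iota _, _, _ => PUnit.unit
  | _, sigma _ c, _, x =>
      ⟨⟨τ ≫ x.1.1, by rw [Category.assoc, x.1.2]⟩, subst T τ c x.2⟩
  | _, delta a F c, γ, x =>
      ⟨U.extMap τ (Category.assoc τ γ a) ≫ x.1,
        ⟨τ ≫ x.2.1.1, subst_aux T τ F x.1 x.2.1.2⟩,
        subst T τ c x.2.2⟩

/-- The action on the arguments of a constructor of a map `f : X ⟶ Y` compatible with the functions
to `D`. -/
noncomputable def map {X Y : E} {T : X ⟶ D} {S : Y ⟶ D} (f : X ⟶ Y) (hf : f ≫ S = T) {Δ : E} :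
    {Γ : E} → (c : IRCode U D Γ) → {γ : Δ ⟶ Γ} → Arg T c γ → Arg S c γ
  | _, iota _, _, _ => PUnit.unit
  | _, sigma _ c, _, x => ⟨x.1, map f hf c x.2⟩
  | _, delta _ _ c, _, x =>
      ⟨x.1 ≫ f, ⟨x.2.1.1, x.2.1.2.imp fun _ e => by rw [e, Category.assoc, hf]⟩,
        map f hf c x.2.2⟩

end IRCode

/-- For a (closed) inductive-recursive definition, given by the finite list of the shapes of its
constructors: a type `X` with a function `T : X → D` that interpret the introduction rules and the
defining equations of `T`. -/
structure IRAlg {U : Univ E} {D : E} (cs : List (IRCode U D (⊤_ E))) where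
  X : E
  T : X ⟶ D
  intro : ∀ (n : Fin cs.length) {Δ : E} {γ : Δ ⟶ ⊤_ E}, (cs.get n).Arg T γ → (Δ ⟶ X)
  intro_subst : ∀ (n : Fin cs.length) {Δ Δ' : E} (τ : Δ' ⟶ Δ) {γ : Δ ⟶ ⊤_ E}
    (x : (cs.get n).Arg T γ), τ ≫ intro n x = intro n ((cs.get n).subst T τ x)
  intro_T : ∀ (n : Fin cs.length) {Δ : E} {γ : Δ ⟶ ⊤_ E} (x : (cs.get n).Arg T γ),
    intro n x ≫ T = (cs.get n).val T x

/-- The elimination rule, in the form of initiality: there is exactly one map to any other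
interpretation of the rules. -/
def IRAlg.IsInitial {U : Univ E} {D : E} {cs : List (IRCode U D (⊤_ E))} (A : IRAlg cs) : Prop :=
  ∀ B : IRAlg cs, ∃! f : A.X ⟶ B.X, ∃ hf : f ≫ B.T = A.T,
    ∀ (n : Fin cs.length) {Δ : E} {γ : Δ ⟶ ⊤_ E} (x : (cs.get n).Arg A.T γ),
      A.intro n x ≫ f = B.intro n ((cs.get n).map f hf x)

/-- Induction-recursion in the universe `U` with values in `D`: every inductive-recursive
definition of a type `X` and a function `X → D` whose argument types are codes of `U` has a solution
with `X` in `U`. -/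
def Univ.SupportsIR (U : Univ E) (D : E) : Prop :=
  ∀ cs : List (IRCode U D (⊤_ E)),
    ∃ A : IRAlg cs, A.IsInitial ∧ U.Small (terminal.from A.X)

/-- Large induction-recursion in `U`: the recursive function may take values in any type. -/
def Univ.SupportsLargeIR (U : Univ E) : Prop :=
  ∀ D : E, U.SupportsIR D

end InductionRecursion

section Hierarchy

variable (E : Type u) [Category.{v} E] [HasFiniteLimits E] [HasFiniteCoproducts E] [LCCC E]

/-- A weakly cumulative hierarchy `U 0 : U 1 : … : U ⊤` of weak universes à la Tarski. The lifts
preserve decoded types up to isomorphism only, and are not required to commute with the codes or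
with each other. -/
structure WeakHierarchy where
  U : WithTop ℕ → Univ E
  codes : ∀ i, (U i).Codes
  isWeak : ∀ i, (codes i).IsWeak
  lift : ∀ {i j}, i < j → Univ.Hom (U i) (U j)
  small : ∀ {i j}, i < j → (U j).Small (terminal.from (U i).Ty)

variable {E}

/-- Small induction-recursion in each `U (i + 1)`: the recursive function takes values in the
next smaller universe `U i`. -/
def WeakHierarchy.SupportsSmallIR (W : WeakHierarchy E) : Prop :=
  ∀ i : ℕ, (W.U ((i + 1 : ℕ) : WithTop ℕ)).SupportsIR (W.U (i : WithTop ℕ)).Ty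

/-- A strictly cumulative hierarchy `V 0 : V 1 : …` of universes with injective codes that extends
the hierarchy `W`. Types are represented by codes of the top universe `U ⊤`, into which all `V i`
decode; every equation below is an equality of such codes or of elements of `V i`. -/
structure StrictHierarchy (W : WeakHierarchy E) where
  V : ℕ → Univ E
  /-- The decoding function of `V i`. -/
  dec : ∀ i, Univ.Hom (V i) (W.U ⊤)
  codes : ∀ i, (V i).Codes
  injective : ∀ i, (codes i).IsInjective
  /-- Decoding commutes strictly with the type formers. -/
  dec_strict : ∀ i, (dec i).IsStrict (codes i) (W.codes ⊤)
  /-- The type `V i`, as a code of `U ⊤`. -/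
  self : ℕ → (⊤_ E ⟶ (W.U ⊤).Ty)
  self_decodes : ∀ i, (W.U ⊤).Decodes (self i) (terminal.from (V i).Ty)
  /-- The code of `V k` in `V i`. -/
  uni : ∀ {k i : ℕ}, k < i → (⊤_ E ⟶ (V i).Ty)
  dec_uni : ∀ {k i : ℕ} (h : k < i), uni h ≫ (dec i).ty = self k
  /-- The strictly functorial lifts, which commute strictly with decoding and with all codes. -/
  lift : ∀ {i j : ℕ}, i ≤ j → Univ.Hom (V i) (V j)
  lift_refl : ∀ i, lift (le_refl i) = Univ.Hom.id (V i)
  lift_trans : ∀ {i j k : ℕ} (h : i ≤ j) (h' : j ≤ k),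
    (lift h).comp (lift h') = lift (h.trans h')
  lift_dec : ∀ {i j : ℕ} (h : i ≤ j), (lift h).comp (dec j) = dec i
  lift_strict : ∀ {i j : ℕ} (h : i ≤ j), (lift h).IsStrict (codes i) (codes j)
  lift_uni : ∀ {k i j : ℕ} (h : k < i) (h' : i ≤ j),
    uni h ≫ (lift h').ty = uni (h.trans_le h')
  /-- The inclusion of the original universe, which decodes as before. -/
  up : ∀ i : ℕ, Univ.Hom (W.U (i : WithTop ℕ)) (V i)
  up_dec : ∀ i : ℕ, (up i).comp (dec i) = W.lift (WithTop.coe_lt_top i)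

end Hierarchy

end TarskiUniverse

/-! `V i` is the free universe over `U ⊤`: inductive-recursive clauses generate its codes, with one
constructor for each type former, one constructor `up m` for each `U m` with `m ≤ i`, and one code
`uni k` for each `V k` with `k < i`, while decoding to `U ⊤` is defined by recursion. Initiality
over `U ⊤` gives the lifts `V i → V j`, and uniqueness makes them strictly functorial. Equivalently,
every strict map into `V i` has exactly one strict section; this induction principle makes the
constructors injective.

It remains to map `V i` to `U i` when the `V k` with `k < i` have codes in `U i`. The codes of `U i`
agree with those of `U ⊤` only up to isomorphism, so initiality does not apply to `U i` itself.
Instead, consider the universe of triples of a code of `U ⊤`, a code of `U i`, and an isomorphism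
between the types that they decode to. It has all the operations of `V i`, strictly over both
projections, so `V i` maps to it over `U ⊤`, and hence to `U i`. The same span identifies `V i` with
the free universe over `U i`, which small induction-recursion constructs in `U (i + 1)`. -/

namespace TarskiUniverse

section Basic

variable {E : Type u} [Category.{v} E]

namespace Univ

variable {U V W : Univ E}

namespace Hom

theorem comp_assoc {X : Univ E} (k : Hom V U) (h : Hom U W) (l : Hom W X) :
    (k.comp h).comp l = k.comp (h.comp l) :=
  Hom.ext (Category.assoc _ _ _) (Category.assoc _ _ _)

theorem id_comp (h : Hom U W) : (Hom.id U).comp h = h :=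
  Hom.ext (Category.id_comp _) (Category.id_comp _)

theorem ext_of_comp {f g : Hom V U} (k : Hom U W) (w : f.comp k = g.comp k) (e : f.ty = g.ty) :
    f = g := by
  apply Hom.ext e
  apply k.isPullback.hom_ext
  · exact congrArg Hom.el w
  · rw [f.isPullback.w, g.isPullback.w, e]

/-- The map of universes over `W` that is given on codes by a map `f` over `W`. -/
noncomputable def ofTy (h : Hom V W) (k : Hom U W) (f : V.Ty ⟶ U.Ty) (w : f ≫ k.ty = h.ty) :
    Hom V U where
  ty := f
  el := k.isPullback.lift h.el (V.p ≫ f) (by rw [Category.assoc, w, h.isPullback.w])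
  isPullback := by
    refine IsPullback.of_right (h₁₂ := k.el) (h₂₂ := k.ty) (v₁₃ := W.p) ?_
      (IsPullback.lift_snd _ _ _ _) k.isPullback
    rw [IsPullback.lift_fst, w]
    exact h.isPullback

theorem ofTy_comp (h : Hom V W) (k : Hom U W) (f : V.Ty ⟶ U.Ty) (w : f ≫ k.ty = h.ty) :
    (h.ofTy k f w).comp k = h :=
  Hom.ext w (IsPullback.lift_fst _ _ _ _)

end Hom

section Decodes

variable {X Y Γ Δ : E} {a : Γ ⟶ U.Ty} {f : X ⟶ Γ}

theorem Decodes.subst (h : U.Decodes a f) {τ : Δ ⟶ Γ} {t : Y ⟶ X} {g : Y ⟶ Δ}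
    (hp : IsPullback t g f τ) : U.Decodes (τ ≫ a) g := by
  obtain ⟨s, hs⟩ := h
  exact ⟨_, hp.paste_horiz hs⟩

theorem Decodes.of_iso (h : U.Decodes a f) (e : Y ≅ X) {g : Y ⟶ Γ} (w : e.hom ≫ f = g) :
    U.Decodes a g := by
  obtain ⟨s, hs⟩ := h
  exact ⟨e.hom ≫ s, hs.of_iso e.symm (Iso.refl _) (Iso.refl _) (Iso.refl _) (by simp)
    (by simp [← w]) (by simp) (by simp)⟩

theorem Decodes.exists_iso {g : Y ⟶ Γ} (h : U.Decodes a f) (h' : U.Decodes a g) :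
    ∃ e : Y ≅ X, e.hom ≫ f = g := by
  obtain ⟨s, hs⟩ := h
  obtain ⟨t, ht⟩ := h'
  exact ⟨ht.isoIsPullback _ _ hs, ht.isoIsPullback_hom_snd _ _ hs⟩

end Decodes

end Univ

end Basic

section Substitution

variable {E : Type u} [Category.{v} E] [HasFiniteLimits E]

namespace Univ

variable {U V W : Univ E}

section ExtMap

variable {Γ Δ Θ : E} (σ : Θ ⟶ Δ) (τ : Δ ⟶ Γ) {a : Γ ⟶ U.Ty} {b : Δ ⟶ U.Ty} {c : Θ ⟶ U.Ty}

theorem extMap_fst (h : b = τ ≫ a) :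
    U.extMap τ h ≫ pullback.fst a U.p = pullback.fst b U.p ≫ τ :=
  pullback.lift_fst _ _ _

theorem extMap_fst_assoc (h : b = τ ≫ a) {Z : E} (k : Γ ⟶ Z) :
    U.extMap τ h ≫ pullback.fst a U.p ≫ k = pullback.fst b U.p ≫ τ ≫ k := by
  rw [← Category.assoc, extMap_fst, Category.assoc]

theorem extMap_snd (h : b = τ ≫ a) : U.extMap τ h ≫ pullback.snd a U.p = pullback.snd b U.p :=
  pullback.lift_snd _ _ _

theorem extMap_trans (h : b = τ ≫ a) (h' : c = σ ≫ b) :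
    U.extMap σ h' ≫ U.extMap τ h = U.extMap (σ ≫ τ) (by rw [h', h, Category.assoc]) :=
  IRCode.extMap_comp σ τ h h' _

theorem extMap_trans_assoc (h : b = τ ≫ a) (h' : c = σ ≫ b) {Z : E} (k : U.ext a ⟶ Z) :
    U.extMap σ h' ≫ U.extMap τ h ≫ k =
      U.extMap (σ ≫ τ) (by rw [h', h, Category.assoc]) ≫ k := by
  rw [← Category.assoc, extMap_trans]

theorem extMap_congr {τ τ' : Δ ⟶ Γ} (e : τ = τ') (h : b = τ ≫ a) (h' : b = τ' ≫ a) :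
    U.extMap τ h = U.extMap τ' h' := by
  subst e; rfl

theorem isPullback_extMap (h : b = τ ≫ a) :
    IsPullback (U.extMap τ h) (U.proj b) (U.proj a) τ := by
  refine IsPullback.of_right (h₁₂ := pullback.snd a U.p) (h₂₂ := a) (v₁₃ := U.p) ?_
    (extMap_fst τ h) (IsPullback.of_hasPullback a U.p).flip
  rw [extMap_snd]
  subst h
  exact (IsPullback.of_hasPullback (τ ≫ a) U.p).flip

end ExtMap

namespace Hom

section ExtIso

variable (h : Hom U W) {Γ Δ : E} {a : Γ ⟶ U.Ty} {b : Γ ⟶ W.Ty}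

theorem ext_hom_ext {Z : E} {f g : Z ⟶ U.ext a}
    (h₁ : f ≫ pullback.fst a U.p = g ≫ pullback.fst a U.p)
    (h₂ : f ≫ pullback.snd a U.p ≫ h.el = g ≫ pullback.snd a U.p ≫ h.el) : f = g := by
  refine pullback.hom_ext h₁ (h.isPullback.hom_ext (by simpa using h₂) ?_)
  rw [Category.assoc, Category.assoc, ← pullback.condition, reassoc_of% h₁]

/-- The extensions of a context by a code and by its image under a map of universes are isomorphic.
The image is any code `b` with a proof of `b = a ≫ h.ty`; for `b := a ≫ h.ty` the isomorphism is
`Hom.extBack` by definition. -/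
noncomputable def extIso (e : b = a ≫ h.ty) : W.ext b ≅ U.ext a where
  hom := pullback.lift (pullback.fst b W.p)
    (h.isPullback.lift (pullback.snd b W.p) (pullback.fst b W.p ≫ a)
      (by rw [Category.assoc, ← e, pullback.condition]))
    (by rw [IsPullback.lift_snd])
  inv := pullback.lift (pullback.fst a U.p) (pullback.snd a U.p ≫ h.el)
    (by rw [e, Category.assoc, h.isPullback.w, pullback.condition_assoc])
  hom_inv_id := by
    apply pullback.hom_ext
    · rw [Category.assoc, pullback.lift_fst, pullback.lift_fst, Category.id_comp]
    · rw [Category.assoc, pullback.lift_snd, pullback.lift_snd_assoc, IsPullback.lift_fst,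
        Category.id_comp]
  inv_hom_id := by
    apply h.ext_hom_ext
    · rw [Category.assoc, pullback.lift_fst, pullback.lift_fst, Category.id_comp]
    · rw [Category.assoc, pullback.lift_snd_assoc, IsPullback.lift_fst, pullback.lift_snd,
        Category.id_comp]

theorem extIso_hom_fst (e : b = a ≫ h.ty) :
    (h.extIso e).hom ≫ pullback.fst a U.p = pullback.fst b W.p :=
  pullback.lift_fst _ _ _

theorem extIso_hom_snd_el (e : b = a ≫ h.ty) :
    (h.extIso e).hom ≫ pullback.snd a U.p ≫ h.el = pullback.snd b W.p :=
  (pullback.lift_snd_assoc _ _ _ _).trans (IsPullback.lift_fst _ _ _ _)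

theorem extIso_hom_extMap (τ : Δ ⟶ Γ) (e : b = a ≫ h.ty) {a' : Δ ⟶ U.Ty} {b' : Δ ⟶ W.Ty}
    (e' : b' = a' ≫ h.ty) (ha : a' = τ ≫ a) (hb : b' = τ ≫ b) :
    (h.extIso e').hom ≫ U.extMap τ ha = W.extMap τ hb ≫ (h.extIso e).hom := by
  apply h.ext_hom_ext
  · rw [Category.assoc, Category.assoc, extMap_fst, extIso_hom_fst, extMap_fst,
      reassoc_of% h.extIso_hom_fst e']
  · rw [Category.assoc, Category.assoc, extIso_hom_snd_el, extMap_snd,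
      reassoc_of% extMap_snd τ ha, extIso_hom_snd_el]

theorem extIso_hom_extMap_assoc (τ : Δ ⟶ Γ) (e : b = a ≫ h.ty) {a' : Δ ⟶ U.Ty} {b' : Δ ⟶ W.Ty}
    (e' : b' = a' ≫ h.ty) (ha : a' = τ ≫ a) (hb : b' = τ ≫ b) {Z : E} (k : U.ext a ⟶ Z) :
    (h.extIso e').hom ≫ U.extMap τ ha ≫ k = W.extMap τ hb ≫ (h.extIso e).hom ≫ k := by
  rw [← Category.assoc, h.extIso_hom_extMap τ e e' ha hb, Category.assoc]

theorem extIso_hom_comp (k : Hom V U) {a : Γ ⟶ V.Ty} {b : Γ ⟶ U.Ty} {c : Γ ⟶ W.Ty}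
    (e : b = a ≫ k.ty) (e' : c = b ≫ h.ty) (e'' : c = a ≫ (k.comp h).ty) :
    (h.extIso e').hom ≫ (k.extIso e).hom = ((k.comp h).extIso e'').hom := by
  apply (k.comp h).ext_hom_ext
  · rw [Category.assoc, extIso_hom_fst, extIso_hom_fst, extIso_hom_fst]
  · rw [(k.comp h).extIso_hom_snd_el e'', Category.assoc]
    exact (congrArg _ ((reassoc_of% k.extIso_hom_snd_el e) h.el)).trans (h.extIso_hom_snd_el e')

end ExtIso

end Hom

/-- The universe of the types that `T` names by elements of `X`. -/
noncomputable def restrict (W : Univ E) {X : E} (T : X ⟶ W.Ty) : Univ E where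
  Ty := X
  El := W.ext T
  p := W.proj T

/-- The decoding of `W.restrict T`. -/
noncomputable def restrictHom (W : Univ E) {X : E} (T : X ⟶ W.Ty) : Hom (W.restrict T) W where
  ty := T
  el := pullback.snd T W.p
  isPullback := (IsPullback.of_hasPullback T W.p).flip

section Fam

variable {Γ Δ Θ : E}

theorem Fam.subst_eq_iff {τ : Δ ⟶ Γ} {x : U.Fam Γ} {y : U.Fam Δ} :
    x.subst τ = y ↔ ∃ h : y.dom = τ ≫ x.dom, U.extMap τ h ≫ x.cod = y.cod := by
  constructor
  · rintro rfl
    exact ⟨rfl, rfl⟩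
  · obtain ⟨dom, cod⟩ := y
    rintro ⟨h, e⟩
    dsimp only at h
    subst h
    exact Fam.ext rfl (heq_of_eq e)

theorem Hom.fam_eq_iff {h : Hom U W} {x : U.Fam Γ} {y : W.Fam Γ} :
    h.fam x = y ↔ ∃ e : y.dom = x.dom ≫ h.ty, (h.extIso e).hom ≫ x.cod ≫ h.ty = y.cod := by
  constructor
  · rintro rfl
    exact ⟨rfl, rfl⟩
  · obtain ⟨dom, cod⟩ := y
    rintro ⟨h, e⟩
    dsimp only at h
    subst h
    exact Fam.ext rfl (heq_of_eq e)

theorem Fam.subst_subst (σ : Θ ⟶ Δ) (τ : Δ ⟶ Γ) (x : U.Fam Γ) :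
    (x.subst τ).subst σ = x.subst (σ ≫ τ) :=
  (Fam.subst_eq_iff.2 ⟨(Category.assoc _ _ _).symm, (extMap_trans_assoc _ _ _ _ _).symm⟩).symm

theorem Hom.fam_subst (h : Hom U W) (τ : Δ ⟶ Γ) (x : U.Fam Γ) :
    h.fam (x.subst τ) = (h.fam x).subst τ := by
  refine Hom.fam_eq_iff.2 ⟨(Category.assoc _ _ _).symm, ?_⟩
  exact (congrArg _ (Category.assoc _ _ _)).trans (h.extIso_hom_extMap_assoc τ rfl _ rfl rfl _)

theorem Hom.fam_comp (k : Hom V U) (h : Hom U W) (x : V.Fam Γ) :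
    (k.comp h).fam x = h.fam (k.fam x) := by
  refine Hom.fam_eq_iff.2 ⟨Category.assoc _ _ _, ?_⟩
  calc
    _ = ((h.extIso rfl).hom ≫ (k.extIso rfl).hom) ≫ x.cod ≫ k.ty ≫ h.ty :=
      congrArg (· ≫ _) (h.extIso_hom_comp k rfl rfl _).symm
    _ = (h.extIso rfl).hom ≫ ((k.extIso rfl).hom ≫ x.cod ≫ k.ty) ≫ h.ty := by
      simp only [Category.assoc]

theorem Hom.fam_id (x : U.Fam Γ) : (Hom.id U).fam x = x := by
  have e : x.dom = x.dom ≫ (Hom.id U).ty := (Category.comp_id _).symm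
  refine Hom.fam_eq_iff.2 ⟨e, ?_⟩
  have h : ((Hom.id U).extIso e).hom = 𝟙 _ := by
    apply (Hom.id U).ext_hom_ext
    · rw [extIso_hom_fst, Category.id_comp]
    · rw [extIso_hom_snd_el, Category.id_comp]
      exact (Category.comp_id _).symm
  rw [h, Category.id_comp]
  exact Category.comp_id _

end Fam

section Decodes

variable {X Γ : E} {a : Γ ⟶ U.Ty} {f : X ⟶ Γ}

theorem decodes_proj (a : Γ ⟶ U.Ty) : U.Decodes a (U.proj a) :=
  ⟨_, (IsPullback.of_hasPullback a U.p).flip⟩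

theorem Decodes.proj {b : Γ ⟶ W.Ty} (h : U.Decodes a f) (h' : W.Decodes b f) :
    W.Decodes b (U.proj a) := by
  obtain ⟨e, he⟩ := h.exists_iso (decodes_proj a)
  exact h'.of_iso e he

theorem Hom.decodes_iff (h : Hom U W) : W.Decodes (a ≫ h.ty) f ↔ U.Decodes a f := by
  constructor
  · intro hf
    obtain ⟨e, he⟩ := (decodes_proj (a ≫ h.ty)).exists_iso hf
    exact (decodes_proj a).of_iso (e ≪≫ h.extIso rfl)
      ((Category.assoc _ _ _).trans ((congrArg _ (h.extIso_hom_fst rfl)).trans he))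
  · rintro ⟨s, hs⟩
    exact ⟨_, hs.paste_horiz h.isPullback⟩

theorem Hom.small (h : Hom U W) (hf : U.Small f) : W.Small f :=
  hf.imp' (· ≫ h.ty) fun _ => h.decodes_iff.2

end Decodes

end Univ

end Substitution

section DependentProducts

variable {E : Type u} [Category.{v} E] [HasFiniteLimits E]

theorem FunCtx.existsUnique_lift {U : Univ E} {D Γ Δ : E} {a : Γ ⟶ U.Ty} (F : FunCtx U D a)
    (γ : Δ ⟶ Γ) {b : Δ ⟶ U.Ty} (hb : b = γ ≫ a) (g : U.ext b ⟶ D) :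
    ∃! δ : Δ ⟶ F.obj, ∃ h : δ ≫ F.proj = γ,
      U.extMap δ (by rw [hb, ← h, Category.assoc]) ≫ F.ev = g := by
  subst hb
  exact F.universal γ g

variable [LCCC E]

theorem LCCC.exists_dependentProduct {Y Γ Z : E} (q : Y ⟶ Γ) (z : Z ⟶ Y) :
    ∃ (P : E) (π : P ⟶ Γ) (ev : pullback π q ⟶ Z), ev ≫ z = pullback.snd π q ∧
      ∀ {Δ : E} (γ : Δ ⟶ Γ) (s : pullback γ q ⟶ Z), s ≫ z = pullback.snd γ q →
        ∃! δ : Δ ⟶ P, ∃ h : δ ≫ π = γ,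
          pullback.lift (pullback.fst γ q ≫ δ) (pullback.snd γ q)
            (by rw [Category.assoc, h, pullback.condition]) ≫ ev = s := by
  let adj := Adjunction.ofIsLeftAdjoint (Over.pullback q)
  let R := (Over.pullback q).rightAdjoint.obj (Over.mk z)
  refine ⟨R.left, R.hom, (adj.counit.app (Over.mk z)).left, Over.w _, fun {Δ} γ s hs => ?_⟩
  let s' : (Over.pullback q).obj (Over.mk γ) ⟶ Over.mk z := Over.homMk s hs
  have transpose (δ : Over.mk γ ⟶ R) : (Over.pullback q).map δ ≫ adj.counit.app _ = s' ↔
      adj.homEquiv _ _ s' = δ := by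
    rw [eq_comm (b := δ), ← Equiv.symm_apply_eq, Adjunction.homEquiv_counit]
  refine ⟨(adj.homEquiv _ _ s').left, ⟨Over.w (adj.homEquiv _ _ s'), ?_⟩, ?_⟩
  · exact congrArg CommaMorphism.left ((transpose _).2 rfl)
  · rintro δ ⟨h, hδ⟩
    exact (congrArg CommaMorphism.left
      ((transpose (Over.homMk δ h)).1 (Over.OverMorphism.ext hδ))).symm

namespace Univ

variable {U W : Univ E}

/-- `P` is the context `Γ, s : Π x : El a. Z x`. -/
theorem exists_piCtx {Γ Z : E} (a : Γ ⟶ U.Ty) (z : Z ⟶ U.ext a) :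
    ∃ (P : E) (π : P ⟶ Γ) (ev : U.ext (π ≫ a) ⟶ Z), ev ≫ z = U.extMap π rfl ∧
      ∀ {Δ : E} (γ : Δ ⟶ Γ) {b : Δ ⟶ U.Ty} (hb : b = γ ≫ a) (s : U.ext b ⟶ Z),
        s ≫ z = U.extMap γ hb → ∃! δ : Δ ⟶ P, ∃ h : δ ≫ π = γ,
          U.extMap δ (by rw [hb, ← h, Category.assoc]) ≫ ev = s := by
  obtain ⟨P, π, ev, hev, huniv⟩ := LCCC.exists_dependentProduct (U.proj a) z
  let κ {Δ : E} (γ : Δ ⟶ Γ) : U.ext (γ ≫ a) ≅ pullback γ (U.proj a) :=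
    (isPullback_extMap (U := U) γ rfl).flip.isoPullback
  have κ_fst {Δ : E} (γ : Δ ⟶ Γ) : (κ γ).hom ≫ pullback.fst γ (U.proj a) = U.proj (γ ≫ a) :=
    IsPullback.isoPullback_hom_fst _
  have κ_snd {Δ : E} (γ : Δ ⟶ Γ) : (κ γ).hom ≫ pullback.snd γ (U.proj a) = U.extMap γ rfl :=
    IsPullback.isoPullback_hom_snd _
  refine ⟨P, π, (κ π).hom ≫ ev, by rw [Category.assoc, hev, κ_snd], ?_⟩
  rintro Δ γ _ rfl s hs
  have extMap_eq (δ : Δ ⟶ P) (h : δ ≫ π = γ) :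
      U.extMap δ (by rw [← h, Category.assoc]) ≫ (κ π).hom =
        (κ γ).hom ≫ pullback.lift (pullback.fst γ (U.proj a) ≫ δ) (pullback.snd γ (U.proj a))
          (by rw [Category.assoc, h, pullback.condition]) := by
    apply pullback.hom_ext
    · rw [Category.assoc (U.extMap δ _), Category.assoc (κ γ).hom, pullback.lift_fst, κ_fst,
        extMap_fst, reassoc_of% κ_fst γ]
    · rw [Category.assoc (U.extMap δ _), Category.assoc (κ γ).hom, pullback.lift_snd, κ_snd,
        κ_snd, extMap_trans]
      exact extMap_congr h _ _
  have iff_lift (δ : Δ ⟶ P) (h : δ ≫ π = γ) :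
      U.extMap δ (by rw [← h, Category.assoc]) ≫ (κ π).hom ≫ ev = s ↔
        pullback.lift (pullback.fst γ (U.proj a) ≫ δ) (pullback.snd γ (U.proj a))
          (by rw [Category.assoc, h, pullback.condition]) ≫ ev = (κ γ).inv ≫ s := by
    rw [Iso.eq_inv_comp, ← Category.assoc, extMap_eq δ h, Category.assoc]
  simp only [exists_congr (iff_lift _)]
  exact huniv γ ((κ γ).inv ≫ s) (by rw [Category.assoc, hs, ← κ_snd, Iso.inv_hom_id_assoc])

end Univ

theorem Univ.nonempty_funCtx (U : Univ E) (D : E) {Γ : E} (a : Γ ⟶ U.Ty) :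
    Nonempty (FunCtx U D a) := by
  obtain ⟨P, π, ev, hev, huniv⟩ := exists_piCtx a (prod.fst : U.ext a ⨯ D ⟶ U.ext a)
  refine ⟨⟨P, π, ev ≫ prod.snd, fun {Δ} γ g => ?_⟩⟩
  obtain ⟨δ, ⟨h, hδ⟩, uniq⟩ :=
    huniv γ rfl (prod.lift (U.extMap γ rfl) g) (prod.lift_fst _ _)
  refine ⟨δ, ⟨h, by rw [← Category.assoc, hδ, prod.lift_snd]⟩, ?_⟩
  rintro δ' ⟨h', hδ'⟩
  refine uniq δ' ⟨h', ?_⟩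
  apply Limits.prod.hom_ext
  · rw [Category.assoc, hev, prod.lift_fst, extMap_trans]
    exact extMap_congr h' _ _
  · rw [Category.assoc, hδ', prod.lift_snd]

end DependentProducts

section Arities

variable {E : Type u} [Category.{v} E]

/-- The arity of an operation on the codes of a universe: what the operation takes as its argument
in a context, with the actions of substitutions and of maps of universes. -/
structure Arity (E : Type u) [Category.{v} E] where
  Arg : Univ E → E → Type v
  subst : ∀ {U : Univ E} {Γ Δ : E}, (Δ ⟶ Γ) → Arg U Γ → Arg U Δ
  map : ∀ {U W : Univ E} {Γ : E}, Univ.Hom U W → Arg U Γ → Arg W Γ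
  subst_subst : ∀ {U : Univ E} {Γ Δ Θ : E} (σ : Θ ⟶ Δ) (τ : Δ ⟶ Γ) (x : Arg U Γ),
    subst σ (subst τ x) = subst (σ ≫ τ) x
  map_subst : ∀ {U W : Univ E} {Γ Δ : E} (h : Univ.Hom U W) (τ : Δ ⟶ Γ) (x : Arg U Γ),
    map h (subst τ x) = subst τ (map h x)
  map_id : ∀ {U : Univ E} {Γ : E} (x : Arg U Γ), map (Univ.Hom.id U) x = x
  map_comp : ∀ {U V W : Univ E} {Γ : E} (h : Univ.Hom U V) (k : Univ.Hom V W) (x : Arg U Γ),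
    map (h.comp k) x = map k (map h x)

namespace Arity

/-- The arity of a family of codes that is indexed by the fixed object `K`. -/
def const (K : E) : Arity E where
  Arg _ Γ := Γ ⟶ K
  subst τ x := τ ≫ x
  map _ x := x
  subst_subst _ _ _ := (Category.assoc _ _ _).symm
  map_subst _ _ _ := rfl
  map_id _ := rfl
  map_comp _ _ _ := rfl

/-- The arguments of arity `α` over `U` are the generalized elements of an object: there is a
generic one. -/
def IsRepresentable (α : Arity E) (U : Univ E) : Prop :=
  ∃ (P : E) (G : α.Arg U P), ∀ {Γ : E} (x : α.Arg U Γ), ∃! σ : Γ ⟶ P, α.subst σ G = x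

theorem isRepresentable_const (K : E) (U : Univ E) : (const K).IsRepresentable U :=
  ⟨K, 𝟙 K, fun x => ⟨x, Category.comp_id x, fun _ h => (Category.comp_id _).symm.trans h⟩⟩

theorem IsRepresentable.exists_name {α : Arity E} {U : Univ E} (hα : α.IsRepresentable U) :
    ∃ (P : E) (G : α.Arg U P) (name : ∀ {Γ : E}, α.Arg U Γ → (Γ ⟶ P)),
      (∀ {Γ : E} (x : α.Arg U Γ), α.subst (name x) G = x) ∧
        ∀ {Γ Δ : E} (τ : Δ ⟶ Γ) (x : α.Arg U Γ), τ ≫ name x = name (α.subst τ x) := by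
  obtain ⟨P, G, hG⟩ := hα
  choose name subst_name name_unique using fun (Γ : E) (x : α.Arg U Γ) => hG x
  exact ⟨P, G, fun {Γ} => name Γ, fun {Γ} => subst_name Γ, fun {Γ Δ} τ x =>
    name_unique Δ _ _ ((α.subst_subst _ _ _).symm.trans (congrArg _ (subst_name Γ x)))⟩

theorem IsRepresentable.exists_op {α : Arity E} {U : Univ E} (hα : α.IsRepresentable U) {T : E}
    {R : ∀ {Γ : E}, α.Arg U Γ → (Γ ⟶ T) → Prop}
    (hR : ∀ {Γ : E} (x : α.Arg U Γ), ∃ a, R x a)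
    (hsubst : ∀ {Γ Δ : E} (τ : Δ ⟶ Γ) (x : α.Arg U Γ) (a : Γ ⟶ T),
      R x a → R (α.subst τ x) (τ ≫ a)) :
    ∃ op : ∀ {Γ : E}, α.Arg U Γ → (Γ ⟶ T), (∀ {Γ : E} (x : α.Arg U Γ), R x (op x)) ∧
      ∀ {Γ Δ : E} (τ : Δ ⟶ Γ) (x : α.Arg U Γ), τ ≫ op x = op (α.subst τ x) := by
  obtain ⟨P, G, name, subst_name, name_subst⟩ := hα.exists_name
  obtain ⟨a, ha⟩ := hR G
  refine ⟨fun x => name x ≫ a, fun x => ?_, fun τ x => ?_⟩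
  · simpa only [subst_name] using hsubst (name x) G a ha
  · exact (Category.assoc _ _ _).symm.trans (congrArg (· ≫ a) (name_subst τ x))

end Arity

/-- A universe with operations on its codes, stable under substitution, of the arities `σ`. -/
structure CodedUniv {ι : Type} (σ : ι → Arity E) where
  U : Univ E
  op : ∀ (o : ι) {Γ : E}, (σ o).Arg U Γ → (Γ ⟶ U.Ty)
  op_subst : ∀ (o : ι) {Γ Δ : E} (τ : Δ ⟶ Γ) (x : (σ o).Arg U Γ),
    τ ≫ op o x = op o ((σ o).subst τ x)

namespace CodedUniv

variable {ι : Type} {σ : ι → Arity E}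

/-- A map of universes that commutes strictly with the operations on codes. -/
def IsHom (A B : CodedUniv σ) (f : Univ.Hom A.U B.U) : Prop :=
  ∀ (o : ι) {Γ : E} (x : (σ o).Arg A.U Γ), A.op o x ≫ f.ty = B.op o ((σ o).map f x)

theorem IsHom.id (A : CodedUniv σ) : IsHom A A (Univ.Hom.id A.U) := fun o _ x => by
  rw [(σ o).map_id]
  exact Category.comp_id _

theorem IsHom.comp {A B C : CodedUniv σ} {f : Univ.Hom A.U B.U} {g : Univ.Hom B.U C.U}
    (hf : IsHom A B f) (hg : IsHom B C g) : IsHom A C (f.comp g) := fun o _ x => by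
  rw [(σ o).map_comp, ← hg, ← hf, Category.assoc]
  rfl

/-- Forget and rename operations. -/
def reindex {κ : Type} (A : CodedUniv σ) (φ : κ → ι) : CodedUniv (σ ∘ φ) where
  U := A.U
  op o := A.op (φ o)
  op_subst o := A.op_subst (φ o)

end CodedUniv

variable [HasFiniteLimits E]

namespace Arity

/-- The arity of the codes of dependent products and sums. -/
noncomputable def fam : Arity E where
  Arg U Γ := U.Fam Γ
  subst τ x := x.subst τ
  map h x := h.fam x
  subst_subst := Univ.Fam.subst_subst
  map_subst h τ x := h.fam_subst τ x
  map_id := Univ.Hom.fam_id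
  map_comp h k x := h.fam_comp k x

/-- The arity of the codes of equality types. -/
def pair : Arity E where
  Arg U Γ := U.Pair Γ
  subst τ x := x.subst τ
  map h x := h.pair x
  subst_subst := by simp [Univ.Pair.subst]
  map_subst := by simp [Univ.Pair.subst, Univ.Hom.pair]
  map_id := by simp [Univ.Hom.pair, Univ.Hom.id]
  map_comp := by simp [Univ.Hom.pair, Univ.Hom.comp]

theorem isRepresentable_fam [LCCC E] (U : Univ E) : fam.IsRepresentable U := by
  obtain ⟨F⟩ := U.nonempty_funCtx U.Ty (𝟙 U.Ty)
  refine ⟨F.obj, (⟨F.proj ≫ 𝟙 _, F.ev⟩ : U.Fam F.obj), fun {Γ} (x : U.Fam Γ) => ?_⟩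
  have subst_eq_iff (σ : Γ ⟶ F.obj) : fam.subst σ (⟨F.proj ≫ 𝟙 _, F.ev⟩ : U.Fam F.obj) = x ↔
      ∃ h : σ ≫ F.proj = x.dom,
        U.extMap σ (a := F.proj ≫ 𝟙 _) (by rw [← h, Category.comp_id]) ≫ F.ev = x.cod := by
    have dom_eq : σ ≫ F.proj ≫ 𝟙 U.Ty = σ ≫ F.proj := congrArg _ (Category.comp_id _)
    exact Univ.Fam.subst_eq_iff.trans
      ⟨fun ⟨h, e⟩ => ⟨(h.trans dom_eq).symm, e⟩, fun ⟨h, e⟩ => ⟨h.symm.trans dom_eq.symm, e⟩⟩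
  simpa only [subst_eq_iff] using F.existsUnique_lift x.dom (Category.comp_id _).symm x.cod

theorem isRepresentable_pair (U : Univ E) : pair.IsRepresentable U := by
  let G : U.Pair (pullback U.p U.p) := ⟨pullback.fst _ _, pullback.snd _ _, pullback.condition⟩
  refine ⟨_, G, fun (x : U.Pair _) => ⟨pullback.lift x.lhs x.rhs x.eq,
    Univ.Pair.ext (pullback.lift_fst _ _ _) (pullback.lift_snd _ _ _), ?_⟩⟩
  rintro σ rfl
  exact pullback.hom_ext (pullback.lift_fst _ _ _).symm (pullback.lift_snd _ _ _).symm

end Arity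

theorem Univ.exists_isPullback {A B C : Univ E} (f : Hom A B) (g : Hom C B) :
    ∃ (P : Univ E) (p₁ : Hom P A) (p₂ : Hom P C), p₁.comp f = p₂.comp g ∧
      IsPullback p₁.ty p₂.ty f.ty g.ty :=
  ⟨A.restrict (pullback.fst f.ty g.ty), A.restrictHom _,
    ((A.restrictHom _).comp f).ofTy g (pullback.snd f.ty g.ty) pullback.condition.symm,
    (Hom.ofTy_comp _ _ _ _).symm, IsPullback.of_hasPullback _ _⟩

namespace CodedUniv

variable {ι : Type} {σ : ι → Arity E}

theorem exists_pullback {A B C : CodedUniv σ} {f : Univ.Hom A.U B.U} {g : Univ.Hom C.U B.U}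
    (hf : IsHom A B f) (hg : IsHom C B g) :
    ∃ (P : CodedUniv σ) (p₁ : Univ.Hom P.U A.U) (p₂ : Univ.Hom P.U C.U),
      IsHom P A p₁ ∧ IsHom P C p₂ ∧ p₁.comp f = p₂.comp g ∧
        ∀ (D : CodedUniv σ) (s : Univ.Hom D.U A.U) (t : Univ.Hom D.U C.U),
          IsHom D A s → IsHom D C t → s.comp f = t.comp g →
            ∃ r : Univ.Hom D.U P.U, IsHom D P r ∧ r.comp p₁ = s ∧ r.comp p₂ = t := by
  obtain ⟨PU, p₁, p₂, hp, hP⟩ := Univ.exists_isPullback f g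
  let P : CodedUniv σ :=
    { U := PU
      op o _ x := hP.lift (A.op o ((σ o).map p₁ x)) (C.op o ((σ o).map p₂ x))
        (by rw [hf, hg, ← (σ o).map_comp, ← (σ o).map_comp, hp])
      op_subst o _ _ τ x := by
        apply hP.hom_ext
        · rw [Category.assoc, hP.lift_fst, hP.lift_fst, A.op_subst, (σ o).map_subst]
        · rw [Category.assoc, hP.lift_snd, hP.lift_snd, C.op_subst, (σ o).map_subst] }
  refine ⟨P, p₁, p₂, fun o _ x => hP.lift_fst _ _ _, fun o _ x => hP.lift_snd _ _ _, hp, ?_⟩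
  intro D s t hs ht e
  let r : Univ.Hom D.U P.U :=
    s.ofTy p₁ (hP.lift s.ty t.ty (congrArg Univ.Hom.ty e)) (hP.lift_fst _ _ _)
  have hr₁ : r.comp p₁ = s := Univ.Hom.ofTy_comp _ _ _ _
  have hr₂ : r.comp p₂ = t := by
    apply Univ.Hom.ext_of_comp g
    · rw [Univ.Hom.comp_assoc, ← hp, ← Univ.Hom.comp_assoc, hr₁, e]
    · exact hP.lift_snd _ _ _
  refine ⟨r, fun o _ x => hP.hom_ext ?_ ?_, hr₁, hr₂⟩
  · rw [Category.assoc, hP.lift_fst, ← (σ o).map_comp, hr₁, ← hs]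
    exact congrArg _ (hP.lift_fst _ _ _)
  · rw [Category.assoc, hP.lift_snd, ← (σ o).map_comp, hr₂, ← ht]
    exact congrArg _ (hP.lift_snd _ _ _)

/-- The induction principle of a universe whose codes are generated by its operations: every strict
map into it has exactly one strict section. -/
def IsInductive (A : CodedUniv σ) : Prop :=
  ∀ (C : CodedUniv σ) (r : Univ.Hom C.U A.U), IsHom C A r →
    ∃! s : Univ.Hom A.U C.U, IsHom A C s ∧ s.comp r = Univ.Hom.id A.U

theorem IsInductive.existsUnique_lift {A B C : CodedUniv σ} (hA : A.IsInductive)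
    {h : Univ.Hom A.U B.U} (hh : IsHom A B h) {k : Univ.Hom C.U B.U} (hk : IsHom C B k) :
    ∃! f : Univ.Hom A.U C.U, IsHom A C f ∧ f.comp k = h := by
  obtain ⟨P, p₁, p₂, hp₁, hp₂, hp, huniv⟩ := exists_pullback hh hk
  obtain ⟨s, ⟨hs, e⟩, s_unique⟩ := hA P p₁ hp₁
  refine ⟨s.comp p₂, ⟨hs.comp hp₂, ?_⟩, ?_⟩
  · rw [Univ.Hom.comp_assoc, ← hp, ← Univ.Hom.comp_assoc, e, Univ.Hom.id_comp]
  · rintro f ⟨hf, ef⟩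
    obtain ⟨r, hr, hr₁, hr₂⟩ := huniv A (Univ.Hom.id _) f (IsHom.id A) hf
      (by rw [ef, Univ.Hom.id_comp])
    rw [← hr₂, s_unique r ⟨hr, hr₁⟩]

theorem IsInductive.nonempty_iso {A A' B : CodedUniv σ} (hA : A.IsInductive)
    (hA' : A'.IsInductive) {h : Univ.Hom A.U B.U} (hh : IsHom A B h) {h' : Univ.Hom A'.U B.U}
    (hh' : IsHom A' B h') : Nonempty (A.U.Ty ≅ A'.U.Ty) := by
  obtain ⟨f, ⟨hf, ef⟩, -⟩ := hA.existsUnique_lift hh hh'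
  obtain ⟨g, ⟨hg, eg⟩, -⟩ := hA'.existsUnique_lift hh' hh
  have fg : f.comp g = Univ.Hom.id _ := (hA.existsUnique_lift hh hh).unique
    ⟨hf.comp hg, by rw [Univ.Hom.comp_assoc, eg, ef]⟩ ⟨IsHom.id A, Univ.Hom.id_comp h⟩
  have gf : g.comp f = Univ.Hom.id _ := (hA'.existsUnique_lift hh' hh').unique
    ⟨hg.comp hf, by rw [Univ.Hom.comp_assoc, ef, eg]⟩ ⟨IsHom.id A', Univ.Hom.id_comp h'⟩
  exact ⟨⟨f.ty, g.ty, congrArg Univ.Hom.ty fg, congrArg Univ.Hom.ty gf⟩⟩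

/-- The idea is to apply the induction principle to `A.U.Ty × Q`, decoded through `A.U.Ty`. -/
theorem IsInductive.exists_cases {A : CodedUniv σ} (hA : A.IsInductive) {Q : E}
    (q : ∀ (o : ι) (Γ : E), (σ o).Arg A.U Γ → (Γ ⟶ Q))
    (q_subst : ∀ (o : ι) {Γ Δ : E} (τ : Δ ⟶ Γ) (x : (σ o).Arg A.U Γ),
      τ ≫ q o Γ x = q o Δ ((σ o).subst τ x)) :
    ∃ m : A.U.Ty ⟶ Q, ∀ (o : ι) {Γ : E} (x : (σ o).Arg A.U Γ), A.op o x ≫ m = q o Γ x := by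
  let r := A.U.restrictHom (prod.fst : A.U.Ty ⨯ Q ⟶ A.U.Ty)
  let C : CodedUniv σ :=
    { U := A.U.restrict (prod.fst : A.U.Ty ⨯ Q ⟶ A.U.Ty)
      op o Γ x := prod.lift (A.op o ((σ o).map r x)) (q o Γ ((σ o).map r x))
      op_subst o _ _ τ x := (prod.comp_lift _ _ _).trans
        (by rw [A.op_subst, q_subst, (σ o).map_subst]) }
  obtain ⟨s, ⟨hs, e⟩, -⟩ := hA C r fun o _ x => prod.lift_fst _ _
  refine ⟨s.ty ≫ prod.snd, fun o Γ x => ?_⟩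
  have hx : (σ o).map r ((σ o).map s x) = x := by rw [← (σ o).map_comp, e, (σ o).map_id]
  calc A.op o x ≫ s.ty ≫ prod.snd = C.op o ((σ o).map s x) ≫ prod.snd :=
        (Category.assoc _ _ _).symm.trans (congrArg (· ≫ prod.snd) (hs o x))
    _ = q o Γ ((σ o).map r ((σ o).map s x)) := prod.lift_snd _ _
    _ = q o Γ x := by rw [hx]

theorem IsInductive.op_injective {A : CodedUniv σ} (hA : A.IsInductive) {o : ι}
    (ho : (σ o).IsRepresentable A.U) (x₀ : (σ o).Arg A.U (⊤_ E)) (Γ : E) :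
    Function.Injective (A.op o : (σ o).Arg A.U Γ → (Γ ⟶ A.U.Ty)) := by
  classical
  obtain ⟨P, G, name, subst_name, name_subst⟩ := ho.exists_name
  obtain ⟨m, hm⟩ := hA.exists_cases (Q := P)
    (Function.update (fun _ Γ _ => terminal.from Γ ≫ name x₀) o fun _ x => name x)
    fun o' Γ Δ τ x => by
      obtain rfl | h := eq_or_ne o' o
      · simp only [Function.update_self, name_subst]
      · simp only [Function.update_of_ne h, ← Category.assoc, terminal.comp_from]
  have op_comp (x : (σ o).Arg A.U Γ) : A.op o x ≫ m = name x := by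
    simpa only [Function.update_self] using hm o x
  intro x y hxy
  rw [← subst_name x, ← op_comp, hxy, op_comp, subst_name]

end CodedUniv

end Arities

section Isomorphisms

variable {E : Type u} [Category.{v} E] [HasFiniteLimits E]

namespace Univ

variable {U W : Univ E}

section Reindexing

variable {Γ Δ Θ : E} {a : Γ ⟶ U.Ty} {b : Γ ⟶ W.Ty} {a' : Δ ⟶ U.Ty} {b' : Δ ⟶ W.Ty}
  {f : U.ext a ⟶ W.ext b} {f' : U.ext a' ⟶ W.ext b'}

theorem ext_hom_ext_of_extMap {Z : E} {τ : Δ ⟶ Γ} (h : a' = τ ≫ a) {s t : Z ⟶ U.ext a'}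
    (h₁ : s ≫ U.proj a' = t ≫ U.proj a') (h₂ : s ≫ U.extMap τ h = t ≫ U.extMap τ h) : s = t :=
  (isPullback_extMap τ h).hom_ext h₂ h₁

theorem exists_reindex (hf : f ≫ W.proj b = U.proj a) (γ : Δ ⟶ Γ) (ha : a' = γ ≫ a)
    (hb : b' = γ ≫ b) :
    ∃ f' : U.ext a' ⟶ W.ext b', f' ≫ W.proj b' = U.proj a' ∧
      f' ≫ W.extMap γ hb = U.extMap γ ha ≫ f :=
  ⟨(isPullback_extMap γ hb).lift (U.extMap γ ha ≫ f) (U.proj a')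
    (by rw [Category.assoc, hf, extMap_fst]), IsPullback.lift_snd _ _ _ _,
    IsPullback.lift_fst _ _ _ _⟩

theorem reindex_of_comp (hf' : f' ≫ W.proj b' = U.proj a') {γ : Δ ⟶ Γ} {ha : a' = γ ≫ a}
    {hb : b' = γ ≫ b} (sq : f' ≫ W.extMap γ hb = U.extMap γ ha ≫ f) {a'' : Θ ⟶ U.Ty}
    {b'' : Θ ⟶ W.Ty} {f'' : U.ext a'' ⟶ W.ext b''} (hf'' : f'' ≫ W.proj b'' = U.proj a'')
    {δ : Θ ⟶ Δ} {γ' : Θ ⟶ Γ} (h : δ ≫ γ = γ') {ha' : a'' = γ' ≫ a} {hb' : b'' = γ' ≫ b}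
    (sq' : f'' ≫ W.extMap γ' hb' = U.extMap γ' ha' ≫ f) (ha'' : a'' = δ ≫ a')
    (hb'' : b'' = δ ≫ b') : f'' ≫ W.extMap δ hb'' = U.extMap δ ha'' ≫ f' := by
  subst h
  apply ext_hom_ext_of_extMap hb
  · rw [Category.assoc f'', extMap_fst, reassoc_of% hf'', Category.assoc (U.extMap δ _), hf',
      extMap_fst]
  · rw [Category.assoc f'', extMap_trans, sq', Category.assoc (U.extMap δ _), sq,
      extMap_trans_assoc]

theorem decodes_of_section {γ : Δ ⟶ Γ} {ha : a' = γ ≫ a} {hb : b' = γ ≫ b}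
    (hf' : f' ≫ W.proj b' = U.proj a') (sq : f' ≫ W.extMap γ hb = U.extMap γ ha ≫ f)
    {s : W.ext b' ⟶ U.ext a} (hs : s ≫ U.proj a = W.proj b' ≫ γ)
    (hsf : s ≫ f = W.extMap γ hb) (hfs : f' ≫ s = U.extMap γ ha) :
    W.Decodes b' (U.proj a') := by
  let g : W.ext b' ⟶ U.ext a' := (isPullback_extMap γ ha).lift s (W.proj b') hs
  have g_proj : g ≫ U.proj a' = W.proj b' := IsPullback.lift_snd _ _ _ _
  have g_extMap : g ≫ U.extMap γ ha = s := IsPullback.lift_fst _ _ _ _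
  have fg : f' ≫ g = 𝟙 _ := by
    apply ext_hom_ext_of_extMap ha
    · rw [Category.assoc, g_proj, hf', Category.id_comp]
    · rw [Category.assoc, g_extMap, hfs, Category.id_comp]
  have gf : g ≫ f' = 𝟙 _ := by
    apply ext_hom_ext_of_extMap hb
    · rw [Category.assoc, hf', g_proj, Category.id_comp]
    · rw [Category.assoc, sq, reassoc_of% g_extMap, hsf, Category.id_comp]
  exact (decodes_proj b').of_iso ⟨f', g, fg, gf⟩ hf'

end Reindexing

variable [LCCC E]

/-- `P` is the context `Γ, f : El a → El b`. -/
theorem exists_homCtx {Γ : E} (a : Γ ⟶ U.Ty) (b : Γ ⟶ W.Ty) :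
    ∃ (P : E) (π : P ⟶ Γ) (f : U.ext (π ≫ a) ⟶ W.ext (π ≫ b)),
      f ≫ W.proj (π ≫ b) = U.proj (π ≫ a) ∧
        ∀ {Δ : E} (γ : Δ ⟶ Γ) {a' : Δ ⟶ U.Ty} {b' : Δ ⟶ W.Ty} (_ : a' = γ ≫ a) (_ : b' = γ ≫ b)
          (g : U.ext a' ⟶ W.ext b'), g ≫ W.proj b' = U.proj a' →
            ∃ (δ : Δ ⟶ P) (_ : δ ≫ π = γ) (ha : a' = δ ≫ π ≫ a) (hb : b' = δ ≫ π ≫ b),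
              g ≫ W.extMap δ hb = U.extMap δ ha ≫ f := by
  obtain ⟨P, π, ev, hev, huniv⟩ := exists_piCtx a (pullback.fst (U.proj a) (W.proj b))
  have hw : (ev ≫ pullback.snd (U.proj a) (W.proj b)) ≫ W.proj b = U.proj (π ≫ a) ≫ π := by
    rw [Category.assoc, ← pullback.condition, reassoc_of% hev, extMap_fst]
  refine ⟨P, π, (isPullback_extMap π rfl).lift (ev ≫ pullback.snd _ _) (U.proj _) hw,
    IsPullback.lift_snd _ _ _ _, ?_⟩
  rintro Δ γ a' b' rfl rfl g hg
  obtain ⟨δ, ⟨rfl, hδ⟩, -⟩ := huniv γ rfl (pullback.lift (U.extMap γ rfl) (g ≫ W.extMap γ rfl)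
    (by rw [Category.assoc, extMap_fst, extMap_fst, reassoc_of% hg])) (pullback.lift_fst _ _ _)
  refine ⟨δ, rfl, Category.assoc _ _ _, Category.assoc _ _ _, ?_⟩
  apply ext_hom_ext_of_extMap (τ := π) rfl
  · rw [Category.assoc g, extMap_fst, reassoc_of% hg, Category.assoc (U.extMap δ _),
      IsPullback.lift_snd, extMap_fst]
  · rw [Category.assoc g, extMap_trans, Category.assoc (U.extMap δ _), IsPullback.lift_fst,
      ← Category.assoc (U.extMap δ _), hδ, pullback.lift_snd]

/-- `P` is the context `Γ, ∀ x : El a. u x = v x`. -/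
theorem exists_forallCtx {Γ Y : E} (a : Γ ⟶ U.Ty) (u v : U.ext a ⟶ Y) :
    ∃ (P : E) (π : P ⟶ Γ), U.extMap π rfl ≫ u = U.extMap π rfl ≫ v ∧
      ∀ {Δ : E} (γ : Δ ⟶ Γ) {a' : Δ ⟶ U.Ty} (ha : a' = γ ≫ a),
        U.extMap γ ha ≫ u = U.extMap γ ha ≫ v → ∃ δ : Δ ⟶ P, δ ≫ π = γ := by
  obtain ⟨P, π, ev, hev, huniv⟩ := exists_piCtx a (equalizer.ι u v)
  refine ⟨P, π, by rw [← hev, Category.assoc, equalizer.condition, Category.assoc], ?_⟩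
  intro Δ γ a' ha h
  obtain ⟨δ, ⟨hδ, -⟩, -⟩ := huniv γ ha (equalizer.lift _ h) (equalizer.lift_ι _ _)
  exact ⟨δ, hδ⟩

/-- `P` is the context `Γ, f is invertible`: a section `s` of `f` is an element of a dependent
product over `El b`, and that `s` is also a retraction is a universally quantified equation. -/
theorem exists_isoCtx {Γ : E} {a : Γ ⟶ U.Ty} {b : Γ ⟶ W.Ty} {f : U.ext a ⟶ W.ext b}
    (hf : f ≫ W.proj b = U.proj a) :
    ∃ (P : E) (π : P ⟶ Γ), W.Decodes (π ≫ b) (U.proj (π ≫ a)) ∧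
      ∀ {Δ : E} {γ : Δ ⟶ Γ} {a' : Δ ⟶ U.Ty} {b' : Δ ⟶ W.Ty} {ha : a' = γ ≫ a} {hb : b' = γ ≫ b}
        (e : U.ext a' ≅ W.ext b'), e.hom ≫ W.proj b' = U.proj a' →
          e.hom ≫ W.extMap γ hb = U.extMap γ ha ≫ f → ∃ δ : Δ ⟶ P, δ ≫ π = γ := by
  obtain ⟨P₁, π₁, s, hs, huniv₁⟩ := exists_piCtx b f
  obtain ⟨f₁, hf₁, sq₁⟩ := exists_reindex hf π₁ rfl rfl
  obtain ⟨P₂, π₂, h₂, huniv₂⟩ := exists_forallCtx (π₁ ≫ a) (f₁ ≫ s) (U.extMap π₁ rfl)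
  obtain ⟨f₂, hf₂, sq₂⟩ := exists_reindex hf (π₂ ≫ π₁) (Category.assoc _ _ a).symm
    (Category.assoc _ _ b).symm
  have s_proj : (W.extMap π₂ rfl ≫ s) ≫ U.proj a = W.proj _ ≫ π₂ ≫ π₁ := by
    rw [← hf, Category.assoc, reassoc_of% hs, extMap_fst, reassoc_of% extMap_fst π₂]
  have s_section : (W.extMap π₂ rfl ≫ s) ≫ f = W.extMap (π₂ ≫ π₁) (Category.assoc _ _ b).symm := by
    rw [Category.assoc, hs, extMap_trans]
  have s_retraction :
      f₂ ≫ W.extMap π₂ rfl ≫ s = U.extMap (π₂ ≫ π₁) (Category.assoc _ _ a).symm := by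
    rw [← Category.assoc f₂, reindex_of_comp hf₁ sq₁ hf₂ rfl sq₂ rfl rfl,
      Category.assoc (U.extMap π₂ _), h₂, extMap_trans]
  refine ⟨P₂, π₂ ≫ π₁, ?_, ?_⟩
  · rw [Category.assoc, Category.assoc]
    exact decodes_of_section hf₂ sq₂ s_proj s_section s_retraction
  intro Δ γ a' b' ha' hb' e he sq
  obtain ⟨δ₁, ⟨rfl, hδ₁⟩, -⟩ := huniv₁ γ hb' (e.inv ≫ U.extMap γ ha')
    (by rw [Category.assoc, ← sq, Iso.inv_hom_id_assoc])
  have sq' := reindex_of_comp hf₁ sq₁ he rfl sq (ha'.trans (Category.assoc _ _ _))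
    (hb'.trans (Category.assoc _ _ _))
  obtain ⟨δ₂, rfl⟩ := huniv₂ δ₁ (ha'.trans (Category.assoc _ _ _)) (by
    rw [← Category.assoc, ← sq', Category.assoc e.hom, hδ₁, Iso.hom_inv_id_assoc, extMap_trans])
  exact ⟨δ₂, (Category.assoc _ _ _).symm⟩

theorem exists_isoUniv (U W : Univ E) :
    ∃ (B : Univ E) (h₁ : Hom B U) (h₂ : Hom B W),
      ∀ {Δ : E} (a : Δ ⟶ U.Ty) (b : Δ ⟶ W.Ty), W.Decodes b (U.proj a) →
        ∃ y : Δ ⟶ B.Ty, y ≫ h₁.ty = a ∧ y ≫ h₂.ty = b := by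
  obtain ⟨P₁, π₁, f, hf, huniv₁⟩ :=
    exists_homCtx (prod.fst : U.Ty ⨯ W.Ty ⟶ U.Ty) (prod.snd : U.Ty ⨯ W.Ty ⟶ W.Ty)
  obtain ⟨P₂, π₂, ⟨t, ht⟩, huniv₂⟩ := exists_isoCtx hf
  refine ⟨U.restrict (π₂ ≫ π₁ ≫ prod.fst), U.restrictHom _, ⟨π₂ ≫ π₁ ≫ prod.snd, t, ht⟩, ?_⟩
  intro Δ a b hab
  obtain ⟨e, he⟩ := (decodes_proj b).exists_iso hab
  obtain ⟨δ₁, -, ha, hb, sq⟩ := huniv₁ (prod.lift a b) (prod.lift_fst _ _).symm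
    (prod.lift_snd _ _).symm e.hom he
  obtain ⟨δ₂, rfl⟩ := huniv₂ e he sq
  exact ⟨δ₂, ((Category.assoc _ _ _).symm.trans ha.symm :),
    ((Category.assoc _ _ _).symm.trans hb.symm :)⟩

end Univ

end Isomorphisms

section DecodedTypes

variable {E : Type u} [Category.{v} E] [HasFiniteLimits E]

theorem Univ.Hom.exists_iso_ext_fam {U V : Univ E} (h : Hom V U) {Γ : E} (x : V.Fam Γ) :
    ∃ q : U.ext (h.fam x).cod ≅ V.ext x.cod,
      q.hom ≫ V.proj x.cod =
        U.proj (h.fam x).cod ≫ (h.extIso (a := x.dom) (b := (h.fam x).dom) rfl).hom := by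
  let i := h.extIso (a := x.dom) (b := (h.fam x).dom) rfl
  have e : (h.fam x).cod = (i.hom ≫ x.cod) ≫ h.ty := (Category.assoc _ _ _).symm
  have := (isPullback_extMap (U := V) (a := x.cod) i.hom rfl).isIso_fst_of_isIso
  refine ⟨h.extIso e ≪≫ asIso (V.extMap (a := x.cod) i.hom rfl), ?_⟩
  rw [Iso.trans_hom, asIso_hom, Category.assoc, extMap_fst, ← Category.assoc, extIso_hom_fst]

variable [LCCC E]

theorem nonempty_dependentProduct_iso {Γ Y Y' Z Z' : E} {f : Y ⟶ Γ} {f' : Y' ⟶ Γ} {z : Z ⟶ Y}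
    {z' : Z' ⟶ Y'} (e : Y ≅ Y') (he : e.hom ≫ f' = f) (q : Z ≅ Z')
    (hq : q.hom ≫ z' = z ≫ e.hom) :
    Nonempty ((Over.pullback f).rightAdjoint.obj (Over.mk z) ≅
      (Over.pullback f').rightAdjoint.obj (Over.mk z')) := by
  subst he
  let adj_e : Over.pullback e.hom ⊣ Over.map e.hom :=
    (Over.mapIso e).symm.toAdjunction.ofNatIsoLeft
      (Adjunction.rightAdjointUniq (Over.mapIso e).toAdjunction (Over.mapPullbackAdj e.hom))
  let adj := ((Adjunction.ofIsLeftAdjoint (Over.pullback f')).comp adj_e).ofNatIsoLeft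
    (Over.pullbackComp e.hom f').symm
  let i := Adjunction.rightAdjointUniq (Adjunction.ofIsLeftAdjoint (Over.pullback (e.hom ≫ f'))) adj
  exact ⟨i.app (Over.mk z) ≪≫ (Over.pullback f').rightAdjoint.mapIso
    (Over.isoMk q hq : Over.mk (z ≫ e.hom) ≅ Over.mk z')⟩

namespace Univ.Codes.IsWeak

variable [HasFiniteCoproducts E] {U V : Univ E} {c : U.Codes}

theorem decodes_pi_fam (hc : c.IsWeak) (h : Hom V U) {Γ : E} (x : V.Fam Γ) :
    U.Decodes (c.pi (h.fam x))
      ((Over.pullback (V.proj x.dom)).rightAdjoint.obj (Over.mk (V.proj x.cod))).hom := by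
  obtain ⟨q, hq⟩ := h.exists_iso_ext_fam x
  obtain ⟨i⟩ := nonempty_dependentProduct_iso (h.extIso rfl) (h.extIso_hom_fst rfl) q hq
  exact (hc.pi (h.fam x)).of_iso ((Over.forget Γ).mapIso i.symm) (Over.w i.inv)

theorem decodes_sigma_fam (hc : c.IsWeak) (h : Hom V U) {Γ : E} (x : V.Fam Γ) :
    U.Decodes (c.sigma (h.fam x)) (V.proj x.cod ≫ V.proj x.dom) := by
  obtain ⟨q, hq⟩ := h.exists_iso_ext_fam x
  refine (hc.sigma (h.fam x)).of_iso q.symm ?_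
  rw [Iso.symm_hom, Iso.inv_comp_eq, ← Category.assoc, hq, Category.assoc]
  exact congrArg _ (h.extIso_hom_fst rfl).symm

theorem decodes_eq_pair (hc : c.IsWeak) (h : Hom V U) {Γ : E} (x : V.Pair Γ) :
    U.Decodes (c.eq (h.pair x)) (equalizer.ι x.lhs x.rhs) := by
  have equalizes_iff {Z : E} (k : Z ⟶ Γ) :
      k ≫ (h.pair x).lhs = k ≫ (h.pair x).rhs ↔ k ≫ x.lhs = k ≫ x.rhs := by
    refine ⟨fun w => h.isPullback.hom_ext (by simpa [Hom.pair] using w) ?_, fun w => ?_⟩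
    · rw [Category.assoc, Category.assoc, x.eq]
    · exact (reassoc_of% w) h.el
  refine (hc.eq (h.pair x)).of_iso
    ⟨equalizer.lift _ ((equalizes_iff _).2 (equalizer.condition _ _)),
      equalizer.lift _ ((equalizes_iff _).1 (equalizer.condition _ _)), ?_, ?_⟩
    (equalizer.lift_ι _ _)
  · apply equalizer.hom_ext
    rw [Category.assoc, equalizer.lift_ι, equalizer.lift_ι, Category.id_comp]
  · apply equalizer.hom_ext
    rw [Category.assoc, equalizer.lift_ι, equalizer.lift_ι, Category.id_comp]

end Univ.Codes.IsWeak

namespace CodedUniv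

variable {ι : Type} {σ : ι → Arity E}

/-- The operations of `A` and of `A'` take arguments from a common universe to codes of isomorphic
types. -/
def DecodesAlike (A A' : CodedUniv σ) (o : ι) : Prop :=
  ∀ {V : Univ E} (f : Univ.Hom V A.U) (g : Univ.Hom V A'.U) {Γ : E} (x : (σ o).Arg V Γ),
    A'.U.Decodes (A'.op o ((σ o).map g x)) (A.U.proj (A.op o ((σ o).map f x)))

theorem exists_span {A A' : CodedUniv σ} (hσ : ∀ (o : ι) (V : Univ E), (σ o).IsRepresentable V)
    (h : ∀ o, DecodesAlike A A' o) :
    ∃ (B : CodedUniv σ) (f : Univ.Hom B.U A.U) (g : Univ.Hom B.U A'.U),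
      IsHom B A f ∧ IsHom B A' g := by
  obtain ⟨V, f, g, huniv⟩ := Univ.exists_isoUniv A.U A'.U
  choose op hop op_subst using fun o => (hσ o V).exists_op
    (R := fun x y => y ≫ f.ty = A.op o ((σ o).map f x) ∧ y ≫ g.ty = A'.op o ((σ o).map g x))
    (fun x => huniv _ _ (h o f g x))
    (fun τ x y hy => by
      rw [Category.assoc, Category.assoc, hy.1, hy.2, A.op_subst, A'.op_subst, (σ o).map_subst,
        (σ o).map_subst]
      exact ⟨rfl, rfl⟩)
  exact ⟨⟨V, op, op_subst⟩, f, g, fun o _ x => (hop o x).1, fun o _ x => (hop o x).2⟩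

end CodedUniv

end DecodedTypes

section Constructors

variable {E : Type u} [Category.{v} E] [HasFiniteLimits E] {B U' V : Univ E}

/-- `c` is the shape of the constructor of an inductive-recursive universe over `B` that introduces
the operation `op` of arity `α`: over every universe `V` with a map to `B`, its arguments correspond
to the arguments of `op`. The correspondence is given by a relation, which makes its compatibility
with substitution and with maps of universes easy to state and to check. -/
structure Arity.Constructor (α : Arity E) (c : IRCode U' B.Ty (⊤_ E))
    (op : ∀ {Γ : E}, α.Arg B Γ → (Γ ⟶ B.Ty)) where
  Rel : ∀ {V : Univ E} (t : Univ.Hom V B) {Γ : E} {γ : Γ ⟶ ⊤_ E},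
    α.Arg V Γ → c.Arg t.ty γ → Prop
  existsUnique_right : ∀ {V : Univ E} (t : Univ.Hom V B) {Γ : E} (γ : Γ ⟶ ⊤_ E)
    (x : α.Arg V Γ), ∃! y : c.Arg t.ty γ, Rel t x y
  existsUnique_left : ∀ {V : Univ E} (t : Univ.Hom V B) {Γ : E} {γ : Γ ⟶ ⊤_ E}
    (y : c.Arg t.ty γ), ∃! x : α.Arg V Γ, Rel t x y
  rel_subst : ∀ {V : Univ E} (t : Univ.Hom V B) {Γ Δ : E} (τ : Δ ⟶ Γ) {γ : Γ ⟶ ⊤_ E}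
    {x : α.Arg V Γ} {y : c.Arg t.ty γ}, Rel t x y → Rel t (α.subst τ x) (c.subst t.ty τ y)
  rel_map : ∀ {V W : Univ E} (f : Univ.Hom V W) (t : Univ.Hom W B) {Γ : E} {γ : Γ ⟶ ⊤_ E}
    {x : α.Arg V Γ} {y : c.Arg (f.comp t).ty γ}, Rel (f.comp t) x y →
      Rel t (α.map f x) (c.map f.ty rfl y)
  val_eq : ∀ {V : Univ E} (t : Univ.Hom V B) {Γ : E} {γ : Γ ⟶ ⊤_ E} {x : α.Arg V Γ}
    {y : c.Arg t.ty γ}, Rel t x y → c.val t.ty y = op (α.map t x)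

namespace Arity

theorem exists_constructor_const {K : E} (hK : U'.Small (terminal.from K))
    {op : ∀ {Γ : E}, (const K).Arg B Γ → (Γ ⟶ B.Ty)}
    (op_subst : ∀ {Γ Δ : E} (τ : Δ ⟶ Γ) (x : (const K).Arg B Γ),
      τ ≫ op x = op ((const K).subst τ x)) :
    ∃ c : IRCode U' B.Ty (⊤_ E), Nonempty ((const K).Constructor c op) := by
  obtain ⟨a, ha⟩ := hK
  obtain ⟨i, -⟩ := ha.exists_iso (Univ.decodes_proj a)
  let c : IRCode U' B.Ty (⊤_ E) := .sigma a (.iota (i.hom ≫ op (𝟙 K)))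
  refine ⟨c, ⟨⟨fun _ _ _ x y => y.1.1 ≫ i.hom = x, ?_, ?_, ?_, ?_, ?_⟩⟩⟩
  · intro V t Γ γ (x : Γ ⟶ K)
    refine ⟨⟨⟨x ≫ i.inv, Subsingleton.elim _ _⟩, PUnit.unit⟩, ?_, ?_⟩
    · exact (Category.assoc _ _ _).trans ((congrArg _ i.inv_hom_id).trans (Category.comp_id x))
    · rintro ⟨⟨γ', h⟩, ⟨⟩⟩ (hx : γ' ≫ i.hom = x)
      obtain rfl : γ' = x ≫ i.inv := (Iso.eq_comp_inv i).2 hx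
      rfl
  · exact fun _ _ _ y => ⟨y.1.1 ≫ i.hom, rfl, fun _ h => h.symm⟩
  · rintro V t Γ Δ τ γ x y rfl
    exact Category.assoc _ _ _
  · exact fun _ _ _ _ _ _ h => h
  · rintro V t Γ γ x y rfl
    calc y.1.1 ≫ i.hom ≫ op (𝟙 K) = (y.1.1 ≫ i.hom) ≫ op (𝟙 K) := (Category.assoc _ _ _).symm
      _ = op ((y.1.1 ≫ i.hom) ≫ 𝟙 K) := op_subst _ _
      _ = op (y.1.1 ≫ i.hom) := congrArg op (Category.comp_id _)

end Arity

theorem Univ.Decodes.isIso_proj {e : ⊤_ E ⟶ U'.Ty} (he : U'.Decodes e (𝟙 (⊤_ E)))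
    {Γ : E} (γ : Γ ⟶ ⊤_ E) : IsIso (U'.proj (γ ≫ e)) := by
  obtain ⟨i, hi⟩ := (he.subst (IsPullback.of_id_snd (f := γ))).exists_iso
    (Univ.decodes_proj (γ ≫ e))
  rw [← hi]
  infer_instance

/-- The context of functions on the unit type: an inductive argument over it is a plain element of
the inductively defined type. -/
noncomputable def FunCtx.unit {e : ⊤_ E ⟶ U'.Ty} (he : U'.Decodes e (𝟙 (⊤_ E))) (D : E) :
    FunCtx U' D e where
  obj := D
  proj := terminal.from D
  ev := U'.proj _
  universal {Γ} γ g := by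
    have := he.isIso_proj γ
    refine ⟨inv (U'.proj (γ ≫ e)) ≫ g, ⟨Subsingleton.elim _ _, ?_⟩, ?_⟩
    · rw [Univ.extMap_fst, IsIso.hom_inv_id_assoc]
    · rintro γ' ⟨h, h'⟩
      rw [Univ.extMap_fst] at h'
      rw [← h', IsIso.inv_hom_id_assoc]

theorem FunCtx.unit_lift_iff {e : ⊤_ E ⟶ U'.Ty} (he : U'.Decodes e (𝟙 (⊤_ E))) {X D Γ : E}
    {γ : Γ ⟶ ⊤_ E} {T : X ⟶ D} {g : U'.ext (γ ≫ e) ⟶ X} {a : Γ ⟶ X} {δ : Γ ⟶ D}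
    (hg : g = U'.proj (γ ≫ e) ≫ a) :
    (∃ h : δ ≫ (FunCtx.unit he D).proj = γ,
      U'.extMap δ (h ▸ Category.assoc δ (FunCtx.unit he D).proj e) ≫ (FunCtx.unit he D).ev =
        g ≫ T) ↔ δ = a ≫ T := by
  subst hg
  have := he.isIso_proj γ
  have h : δ ≫ (FunCtx.unit he D).proj = γ := Subsingleton.elim _ _
  rw [exists_prop_of_true h, Category.assoc (U'.proj _), ← cancel_epi (U'.proj (γ ≫ e))]
  exact ⟨(Univ.extMap_fst _ _).symm.trans, (Univ.extMap_fst _ _).trans⟩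

theorem Univ.Decodes.existsUnique_proj_comp {e : ⊤_ E ⟶ U'.Ty} (he : U'.Decodes e (𝟙 (⊤_ E)))
    {X Γ : E} (γ : Γ ⟶ ⊤_ E) (g : U'.ext (γ ≫ e) ⟶ X) :
    ∃! a : Γ ⟶ X, g = U'.proj (γ ≫ e) ≫ a := by
  have := he.isIso_proj γ
  exact ⟨inv (U'.proj (γ ≫ e)) ≫ g, (IsIso.hom_inv_id_assoc _ _).symm,
    fun a h => by rw [h, IsIso.inv_hom_id_assoc]⟩

namespace Arity

variable (h : Univ.Hom B U')

/-- The generic family of codes of `B`, in the context `A : B.Ty, F : El A → B.Ty`. -/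
noncomputable def genericFam (F : FunCtx U' B.Ty h.ty) : B.Fam F.obj :=
  ⟨F.proj, (h.extIso rfl).inv ≫ F.ev⟩

theorem genericFam_subst {t : Univ.Hom V B} {F : FunCtx U' B.Ty h.ty} {Γ : E} {x : V.Fam Γ}
    {n : Γ ⟶ F.obj} (hn : n ≫ F.proj = x.dom ≫ t.ty)
    (hb : (x.dom ≫ t.ty) ≫ h.ty = x.dom ≫ (t.comp h).ty)
    (hev : U'.extMap n (b := (x.dom ≫ t.ty) ≫ h.ty) (by rw [← hn, Category.assoc]) ≫ F.ev =
      (((t.comp h).extIso hb).hom ≫ x.cod) ≫ t.ty) :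
    (genericFam h F).subst n = t.fam x := by
  refine Univ.Fam.subst_eq_iff.2 ⟨hn.symm, ?_⟩
  let i : U'.ext ((x.dom ≫ t.ty) ≫ h.ty) ≅ B.ext (x.dom ≫ t.ty) := h.extIso rfl
  have i_comp : i.hom ≫ (t.extIso rfl).hom = ((t.comp h).extIso hb).hom :=
    h.extIso_hom_comp t rfl rfl hb
  apply (cancel_epi i.hom).1
  calc i.hom ≫ B.extMap n hn.symm ≫ (h.extIso (a := F.proj) rfl).inv ≫ F.ev
    _ = U'.extMap n (by rw [← hn, Category.assoc]) ≫ F.ev := by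
      rw [h.extIso_hom_extMap_assoc n (a := F.proj) rfl rfl hn.symm
        (by rw [← hn, Category.assoc]), Iso.hom_inv_id_assoc]
    _ = (i.hom ≫ (t.extIso rfl).hom ≫ x.cod) ≫ t.ty := by
      rw [hev, ← i_comp, Category.assoc i.hom]
    _ = i.hom ≫ (t.extIso rfl).hom ≫ x.cod ≫ t.ty := by simp only [Category.assoc]

/-- The shape of the constructors of the codes of dependent products and sums: a code `A`, and a
family of codes `El A → V`. -/
noncomputable def famCode {e : ⊤_ E ⟶ U'.Ty} (he : U'.Decodes e (𝟙 (⊤_ E)))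
    (F : FunCtx U' B.Ty h.ty) (d : F.obj ⟶ B.Ty) : IRCode U' B.Ty (⊤_ E) :=
  .delta e (.unit he B.Ty) (.delta h.ty F (.iota d))

/-- The arguments `y` of a constructor of shape `famCode` are given by the family of codes `x`. -/
def FamRel {e : ⊤_ E ⟶ U'.Ty} {he : U'.Decodes e (𝟙 (⊤_ E))} {F : FunCtx U' B.Ty h.ty}
    {d : F.obj ⟶ B.Ty} (t : Univ.Hom V B) {Γ : E} {γ : Γ ⟶ ⊤_ E} (x : V.Fam Γ)
    (y : (famCode h he F d).Arg t.ty γ) : Prop :=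
  y.1 = U'.proj (γ ≫ e) ≫ x.dom ∧ ∃ hb : y.2.1.1 ≫ h.ty = x.dom ≫ (t.comp h).ty,
    y.2.2.1 = ((t.comp h).extIso hb).hom ≫ x.cod

section FamRel

variable {e : ⊤_ E ⟶ U'.Ty} {he : U'.Decodes e (𝟙 (⊤_ E))} {F : FunCtx U' B.Ty h.ty}
  {d : F.obj ⟶ B.Ty} (t : Univ.Hom V B) {Γ Δ : E}

theorem existsUnique_famRel_right (γ : Γ ⟶ ⊤_ E) (x : V.Fam Γ) :
    ∃! y : (famCode h he F d).Arg t.ty γ, FamRel h t x y := by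
  obtain ⟨n, hn, n_unique⟩ := F.universal (x.dom ≫ t.ty)
    ((((t.comp h).extIso (Category.assoc _ _ _)).hom ≫ x.cod) ≫ t.ty)
  refine ⟨⟨U'.proj (γ ≫ e) ≫ x.dom, ⟨x.dom ≫ t.ty, (FunCtx.unit_lift_iff he rfl).2 rfl⟩,
    ((t.comp h).extIso (Category.assoc _ _ _)).hom ≫ x.cod, ⟨n, hn⟩, PUnit.unit⟩,
    ⟨rfl, Category.assoc _ _ _, rfl⟩, ?_⟩
  rintro ⟨g, ⟨A, hA⟩, g', ⟨n', hn'⟩, ⟨⟩⟩ ⟨hg, hb, hg'⟩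
  obtain rfl : g = _ := hg
  obtain rfl := (FunCtx.unit_lift_iff he rfl).1 hA
  obtain rfl : g' = ((t.comp h).extIso (Category.assoc _ _ _)).hom ≫ x.cod := hg'
  obtain rfl := n_unique n' hn'
  rfl

theorem existsUnique_famRel_left {γ : Γ ⟶ ⊤_ E} (y : (famCode h he F d).Arg t.ty γ) :
    ∃! x : V.Fam Γ, FamRel h t x y := by
  obtain ⟨A, hA, A_unique⟩ := he.existsUnique_proj_comp γ y.1
  have hb : y.2.1.1 ≫ h.ty = A ≫ (t.comp h).ty :=
    (congrArg (· ≫ h.ty) ((FunCtx.unit_lift_iff he hA).1 y.2.1.2)).trans (Category.assoc _ _ _)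
  refine ⟨⟨A, ((t.comp h).extIso hb).inv ≫ y.2.2.1⟩,
    ⟨hA, hb, (Iso.hom_inv_id_assoc _ _).symm⟩, ?_⟩
  rintro ⟨A', c⟩ ⟨hA', hb', hc⟩
  obtain rfl := A_unique A' hA'
  exact congrArg (Univ.Fam.mk A') ((Iso.eq_inv_comp _).2 hc.symm)

variable {h t}

theorem FamRel.subst (τ : Δ ⟶ Γ) {γ : Γ ⟶ ⊤_ E} {x : V.Fam Γ}
    {y : (famCode h he F d).Arg t.ty γ} (hxy : FamRel h t x y) :
    FamRel h t (x.subst τ) ((famCode h he F d).subst t.ty τ y) := by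
  obtain ⟨hA, hb, hc⟩ := hxy
  have hb' : (τ ≫ y.2.1.1) ≫ h.ty = (τ ≫ x.dom) ≫ (t.comp h).ty :=
    (Category.assoc _ _ _).trans ((congrArg _ hb).trans (Category.assoc _ _ _).symm)
  exact ⟨(congrArg _ hA).trans (Univ.extMap_fst_assoc _ _ _), hb', (congrArg _ hc).trans
    ((t.comp h).extIso_hom_extMap_assoc τ hb hb' rfl (Category.assoc _ _ _) x.cod).symm⟩

theorem FamRel.map {f : Univ.Hom V W} {t : Univ.Hom W B} {γ : Γ ⟶ ⊤_ E} {x : V.Fam Γ}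
    {y : (famCode h he F d).Arg (f.comp t).ty γ} (hxy : FamRel h (f.comp t) x y) :
    FamRel h t (f.fam x) ((famCode h he F d).map f.ty rfl y) := by
  obtain ⟨hA, hb, hc⟩ := hxy
  have hb' : y.2.1.1 ≫ h.ty = (x.dom ≫ f.ty) ≫ (t.comp h).ty :=
    hb.trans ((congrArg _ (Category.assoc _ _ _)).trans (Category.assoc _ _ _).symm)
  have extIso_eq (k : Univ.Hom V U') (hk : f.comp (t.comp h) = k)
      (e : y.2.1.1 ≫ h.ty = x.dom ≫ k.ty) :
      (k.extIso e).hom = ((t.comp h).extIso hb').hom ≫ (f.extIso (a := x.dom) rfl).hom := by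
    subst hk
    exact ((t.comp h).extIso_hom_comp f rfl hb' e).symm
  refine ⟨(congrArg (· ≫ f.ty) hA).trans (Category.assoc _ _ _), hb', ?_⟩
  have cod_eq : y.2.2.1 =
      (((t.comp h).extIso hb').hom ≫ (f.extIso (a := x.dom) rfl).hom) ≫ x.cod :=
    hc.trans (congrArg (· ≫ x.cod) (extIso_eq _ (Univ.Hom.comp_assoc f t h).symm hb))
  exact (congrArg (· ≫ f.ty) cod_eq).trans
    ((Category.assoc _ _ _).trans (Category.assoc _ _ _))

theorem FamRel.genericFam_subst {γ : Γ ⟶ ⊤_ E} {x : V.Fam Γ}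
    {y : (famCode h he F d).Arg t.ty γ} (hxy : FamRel h t x y) :
    (genericFam h F).subst y.2.2.2.1.1 = t.fam x := by
  obtain ⟨hA, hb, hc⟩ := hxy
  have dom_eq : y.2.1.1 = x.dom ≫ t.ty := (FunCtx.unit_lift_iff he hA).1 y.2.1.2
  obtain ⟨g, ⟨A, hA'⟩, g', ⟨n, hn, hev⟩, ⟨⟩⟩ := y
  obtain rfl : A = _ := dom_eq
  obtain rfl : g' = ((t.comp h).extIso (Category.assoc x.dom t.ty h.ty)).hom ≫ x.cod := hc
  exact Arity.genericFam_subst h hn hb hev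

end FamRel

theorem exists_constructor_fam [LCCC E] (h : Univ.Hom B U') (hunit : U'.Small (𝟙 (⊤_ E)))
    {op : ∀ {Γ : E}, fam.Arg B Γ → (Γ ⟶ B.Ty)}
    (op_subst : ∀ {Γ Δ : E} (τ : Δ ⟶ Γ) (x : fam.Arg B Γ), τ ≫ op x = op (fam.subst τ x)) :
    ∃ c : IRCode U' B.Ty (⊤_ E), Nonempty (fam.Constructor c op) := by
  obtain ⟨e, he⟩ := hunit
  obtain ⟨F⟩ := U'.nonempty_funCtx B.Ty h.ty
  exact ⟨famCode h he F (op (genericFam h F : B.Fam _)), ⟨{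
    Rel := FamRel h
    existsUnique_right := existsUnique_famRel_right h
    existsUnique_left := existsUnique_famRel_left h
    rel_subst _ _ _ τ _ _ _ hxy := hxy.subst τ
    rel_map _ _ _ _ _ _ hxy := hxy.map
    val_eq _ _ _ _ _ hxy := (op_subst _ _).trans (congrArg op hxy.genericFam_subst) }⟩⟩

end Arity

end Constructors

section PairConstructor

variable {E : Type u} [Category.{v} E] [HasFiniteLimits E] {B U' V : Univ E}

theorem Univ.comp_snd_comp_p {Γ Δ : E} {a : Γ ⟶ V.Ty} (δ : Δ ⟶ V.ext a) :
    (δ ≫ pullback.snd a V.p) ≫ V.p = (δ ≫ V.proj a) ≫ a := by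
  rw [Category.assoc, Category.assoc, pullback.condition]

namespace Arity

variable (h : Univ.Hom B U')

/-- The generic pair of elements of `B`, in the context `A : B.Ty, a : El A, b : El A`. -/
noncomputable def genericPair : B.Pair (U'.ext (U'.proj h.ty ≫ h.ty)) where
  lhs := h.isPullback.lift (U'.proj (U'.proj h.ty ≫ h.ty) ≫ pullback.snd h.ty U'.p)
    (U'.proj (U'.proj h.ty ≫ h.ty) ≫ U'.proj h.ty)
    (by rw [Category.assoc, Category.assoc, pullback.condition])
  rhs := h.isPullback.lift (pullback.snd (U'.proj h.ty ≫ h.ty) U'.p)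
    (U'.proj (U'.proj h.ty ≫ h.ty) ≫ U'.proj h.ty)
    (by rw [← pullback.condition, Category.assoc])
  eq := by rw [IsPullback.lift_snd, IsPullback.lift_snd]

theorem genericPair_subst {t : Univ.Hom V B} {Γ : E} {x : V.Pair Γ} {δ : Γ ⟶ U'.ext h.ty}
    {ε : Γ ⟶ U'.ext (U'.proj h.ty ≫ h.ty)} (hε : ε ≫ U'.proj _ = δ)
    (hδ : δ ≫ U'.proj h.ty = x.lhs ≫ V.p ≫ t.ty)
    (hlhs : δ ≫ pullback.snd _ _ = x.lhs ≫ (t.comp h).el)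
    (hrhs : ε ≫ pullback.snd _ _ = x.rhs ≫ (t.comp h).el) :
    (genericPair h).subst ε = t.pair x := by
  subst hε
  rw [Category.assoc] at hδ hlhs
  apply Univ.Pair.ext <;> apply h.isPullback.hom_ext
  · simpa [genericPair, Univ.Pair.subst, Univ.Hom.pair, Univ.Hom.comp] using hlhs
  · simpa [genericPair, Univ.Pair.subst, Univ.Hom.pair, t.isPullback.w] using hδ
  · simpa [genericPair, Univ.Pair.subst, Univ.Hom.pair, Univ.Hom.comp] using hrhs
  · simpa [genericPair, Univ.Pair.subst, Univ.Hom.pair, t.isPullback.w, ← reassoc_of% x.eq]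
      using hδ

/-- The shape of the constructor of the codes of equality types: a code `A`, and two elements
of `El A`. -/
noncomputable def pairCode {e : ⊤_ E ⟶ U'.Ty} (he : U'.Decodes e (𝟙 (⊤_ E)))
    (d : U'.ext (U'.proj h.ty ≫ h.ty) ⟶ B.Ty) : IRCode U' B.Ty (⊤_ E) :=
  .delta e (.unit he B.Ty) (.sigma h.ty (.sigma (U'.proj h.ty ≫ h.ty) (.iota d)))

/-- The arguments `y` of a constructor of shape `pairCode` are given by the pair of elements `x`. -/
def PairRel {e : ⊤_ E ⟶ U'.Ty} {he : U'.Decodes e (𝟙 (⊤_ E))}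
    {d : U'.ext (U'.proj h.ty ≫ h.ty) ⟶ B.Ty} (t : Univ.Hom V B) {Γ : E} {γ : Γ ⟶ ⊤_ E}
    (x : V.Pair Γ) (y : (pairCode h he d).Arg t.ty γ) : Prop :=
  y.1 = U'.proj (γ ≫ e) ≫ x.lhs ≫ V.p ∧
    y.2.2.1.1 ≫ pullback.snd h.ty U'.p = x.lhs ≫ (t.comp h).el ∧
      y.2.2.2.1.1 ≫ pullback.snd (U'.proj h.ty ≫ h.ty) U'.p = x.rhs ≫ (t.comp h).el

section PairRel

variable {e : ⊤_ E ⟶ U'.Ty} {he : U'.Decodes e (𝟙 (⊤_ E))}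
  {d : U'.ext (U'.proj h.ty ≫ h.ty) ⟶ B.Ty} (t : Univ.Hom V B) {Γ Δ : E}

theorem existsUnique_pairRel_right (γ : Γ ⟶ ⊤_ E) (x : V.Pair Γ) :
    ∃! y : (pairCode h he d).Arg t.ty γ, PairRel h t x y := by
  have hA : U'.proj (γ ≫ e) ≫ x.lhs ≫ V.p = U'.proj (γ ≫ e) ≫ (x.lhs ≫ V.p) := rfl
  have hlhs : ((x.lhs ≫ V.p) ≫ t.ty) ≫ h.ty = (x.lhs ≫ (t.comp h).el) ≫ U'.p := by
    rw [Category.assoc x.lhs (t.comp h).el, (t.comp h).isPullback.w]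
    simp only [Category.assoc, Univ.Hom.comp]
  have hrhs : pullback.lift _ _ hlhs ≫ U'.proj h.ty ≫ h.ty =
      (x.rhs ≫ (t.comp h).el) ≫ U'.p := by
    rw [pullback.lift_fst_assoc, hlhs, Category.assoc, Category.assoc, (t.comp h).isPullback.w,
      reassoc_of% x.eq]
  refine ⟨⟨U'.proj (γ ≫ e) ≫ x.lhs ≫ V.p, ⟨(x.lhs ≫ V.p) ≫ t.ty,
      (FunCtx.unit_lift_iff he hA).2 rfl⟩, ⟨pullback.lift _ _ hlhs, pullback.lift_fst _ _ _⟩,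
      ⟨pullback.lift _ _ hrhs, pullback.lift_fst _ _ _⟩, PUnit.unit⟩,
    ⟨rfl, pullback.lift_snd _ _ _, pullback.lift_snd _ _ _⟩, ?_⟩
  rintro ⟨g, ⟨A, hA'⟩, ⟨δ, hδ⟩, ⟨ε, hε⟩, ⟨⟩⟩ ⟨hg, hl, hr⟩
  obtain rfl : g = _ := hg
  obtain rfl := (FunCtx.unit_lift_iff he hA).1 hA'
  obtain rfl : δ = pullback.lift _ _ hlhs := pullback.hom_ext
    (hδ.trans (pullback.lift_fst _ _ _).symm) (hl.trans (pullback.lift_snd _ _ _).symm)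
  obtain rfl : ε = pullback.lift _ _ hrhs := pullback.hom_ext
    (hε.trans (pullback.lift_fst _ _ _).symm) (hr.trans (pullback.lift_snd _ _ _).symm)
  rfl

theorem existsUnique_pairRel_left {γ : Γ ⟶ ⊤_ E} (y : (pairCode h he d).Arg t.ty γ) :
    ∃! x : V.Pair Γ, PairRel h t x y := by
  obtain ⟨A, hA, A_unique⟩ := he.existsUnique_proj_comp γ y.1
  have dom_eq : y.2.1.1 = A ≫ t.ty := (FunCtx.unit_lift_iff he hA).1 y.2.1.2
  obtain ⟨g, ⟨A', hA'⟩, ⟨δ, hδ⟩, ⟨ε, hε⟩, ⟨⟩⟩ := y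
  obtain rfl : A' = _ := dom_eq
  have hδ' : (δ ≫ pullback.snd h.ty U'.p) ≫ U'.p = A ≫ (t.comp h).ty :=
    calc _ = (δ ≫ U'.proj h.ty) ≫ h.ty := Univ.comp_snd_comp_p δ
      _ = (A ≫ t.ty) ≫ h.ty := congrArg (· ≫ h.ty) hδ
      _ = A ≫ (t.comp h).ty := Category.assoc _ _ _
  have hε' : (ε ≫ pullback.snd (U'.proj h.ty ≫ h.ty) U'.p) ≫ U'.p = A ≫ (t.comp h).ty :=
    calc _ = (ε ≫ U'.proj (U'.proj h.ty ≫ h.ty)) ≫ U'.proj h.ty ≫ h.ty := Univ.comp_snd_comp_p ε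
      _ = ((ε ≫ U'.proj (U'.proj h.ty ≫ h.ty)) ≫ U'.proj h.ty) ≫ h.ty :=
        (Category.assoc _ _ _).symm
      _ = (δ ≫ U'.proj h.ty) ≫ h.ty := congrArg (fun φ => (φ ≫ U'.proj h.ty) ≫ h.ty) hε
      _ = (A ≫ t.ty) ≫ h.ty := congrArg (· ≫ h.ty) hδ
      _ = A ≫ (t.comp h).ty := Category.assoc _ _ _
  let k := (t.comp h).isPullback
  refine ⟨⟨k.lift _ _ hδ', k.lift _ _ hε', (k.lift_snd _ _ _).trans (k.lift_snd _ _ _).symm⟩,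
    ⟨hA.trans (congrArg _ (k.lift_snd _ _ _).symm), (k.lift_fst _ _ _).symm,
      (k.lift_fst _ _ _).symm⟩, ?_⟩
  rintro x ⟨hA', hl, hr⟩
  have dom_eq : x.lhs ≫ V.p = A := A_unique _ hA'
  exact Univ.Pair.ext
    (k.hom_ext (hl.symm.trans (k.lift_fst _ _ _).symm) (dom_eq.trans (k.lift_snd _ _ _).symm))
    (k.hom_ext (hr.symm.trans (k.lift_fst _ _ _).symm)
      ((x.eq.symm.trans dom_eq).trans (k.lift_snd _ _ _).symm))

variable {h t}

theorem PairRel.subst (τ : Δ ⟶ Γ) {γ : Γ ⟶ ⊤_ E} {x : V.Pair Γ}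
    {y : (pairCode h he d).Arg t.ty γ} (hxy : PairRel h t x y) :
    PairRel h t (x.subst τ) ((pairCode h he d).subst t.ty τ y) := by
  obtain ⟨hA, hlhs, hrhs⟩ := hxy
  refine ⟨(congrArg _ hA).trans ?_, ?_, ?_⟩
  · exact (Univ.extMap_fst_assoc _ _ _).trans (congrArg _ (Category.assoc _ _ _).symm)
  · exact (Category.assoc _ _ _).trans ((congrArg (τ ≫ ·) hlhs).trans (Category.assoc _ _ _).symm)
  · exact (Category.assoc _ _ _).trans ((congrArg (τ ≫ ·) hrhs).trans (Category.assoc _ _ _).symm)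

theorem PairRel.map {W : Univ E} {f : Univ.Hom V W} {t : Univ.Hom W B} {γ : Γ ⟶ ⊤_ E}
    {x : V.Pair Γ} {y : (pairCode h he d).Arg (f.comp t).ty γ} (hxy : PairRel h (f.comp t) x y) :
    PairRel h t (f.pair x) ((pairCode h he d).map f.ty rfl y) := by
  obtain ⟨hA, hlhs, hrhs⟩ := hxy
  have el_eq : ((f.comp t).comp h).el = f.el ≫ (t.comp h).el := Category.assoc _ _ _
  refine ⟨?_, ?_, ?_⟩
  · calc y.1 ≫ f.ty = (U'.proj (γ ≫ e) ≫ x.lhs ≫ V.p) ≫ f.ty := congrArg (· ≫ f.ty) hA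
      _ = U'.proj (γ ≫ e) ≫ (x.lhs ≫ f.el) ≫ W.p := by
        simp only [Category.assoc, f.isPullback.w]
  · exact (hlhs.trans (congrArg _ el_eq)).trans (Category.assoc _ _ _).symm
  · exact (hrhs.trans (congrArg _ el_eq)).trans (Category.assoc _ _ _).symm

theorem PairRel.genericPair_subst {γ : Γ ⟶ ⊤_ E} {x : V.Pair Γ}
    {y : (pairCode h he d).Arg t.ty γ} (hxy : PairRel h t x y) :
    (genericPair h).subst y.2.2.2.1.1 = t.pair x := by
  obtain ⟨hA, hlhs, hrhs⟩ := hxy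
  have dom_eq : y.2.1.1 = (x.lhs ≫ V.p) ≫ t.ty := (FunCtx.unit_lift_iff he hA).1 y.2.1.2
  exact Arity.genericPair_subst h y.2.2.2.1.2
    ((y.2.2.1.2.trans dom_eq).trans (Category.assoc _ _ _)) hlhs hrhs

end PairRel

theorem exists_constructor_pair (h : Univ.Hom B U') (hunit : U'.Small (𝟙 (⊤_ E)))
    {op : ∀ {Γ : E}, pair.Arg B Γ → (Γ ⟶ B.Ty)}
    (op_subst : ∀ {Γ Δ : E} (τ : Δ ⟶ Γ) (x : pair.Arg B Γ), τ ≫ op x = op (pair.subst τ x)) :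
    ∃ c : IRCode U' B.Ty (⊤_ E), Nonempty (pair.Constructor c op) := by
  obtain ⟨e, he⟩ := hunit
  exact ⟨pairCode h he (op (genericPair h : B.Pair _)), ⟨{
    Rel := PairRel h
    existsUnique_right := existsUnique_pairRel_right h
    existsUnique_left := existsUnique_pairRel_left h
    rel_subst _ _ _ τ _ _ _ hxy := hxy.subst τ
    rel_map _ _ _ _ _ _ hxy := hxy.map
    val_eq _ _ _ _ _ hxy := (op_subst _ _).trans (congrArg op hxy.genericPair_subst) }⟩⟩

end Arity

end PairConstructor

section InitialUniverses

variable {E : Type u} [Category.{v} E]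

theorem CodedUniv.isInductive_of_existsUnique_hom {ι : Type} {σ : ι → Arity E}
    {A B : CodedUniv σ} {t : Univ.Hom A.U B.U} (ht : IsHom A B t)
    (h : ∀ (C : CodedUniv σ) (k : Univ.Hom C.U B.U), IsHom C B k →
      ∃! s : Univ.Hom A.U C.U, IsHom A C s ∧ s.comp k = t) : A.IsInductive := by
  intro C r hr
  obtain ⟨s, ⟨hs, e⟩, s_unique⟩ := h C (r.comp t) (hr.comp ht)
  refine ⟨s, ⟨hs, (h A t ht).unique ⟨hs.comp hr, ?_⟩ ⟨IsHom.id A, Univ.Hom.id_comp t⟩⟩, ?_⟩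
  · rw [Univ.Hom.comp_assoc, e]
  · rintro s' ⟨hs', e'⟩
    exact s_unique s' ⟨hs', by rw [← Univ.Hom.comp_assoc, e', Univ.Hom.id_comp]⟩

theorem exists_list_get_comp_equiv {ι β : Type*} [Finite ι] (c : ι → β) :
    ∃ (l : List β) (φ : ι ≃ Fin l.length), c = fun o => l.get (φ o) := by
  obtain ⟨n, ⟨φ⟩⟩ := Finite.exists_equiv_fin ι
  refine ⟨List.ofFn (c ∘ φ.symm), φ.trans (finCongr List.length_ofFn.symm), ?_⟩
  funext o
  simp

variable [HasFiniteLimits E]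

namespace Arity.Constructor

variable {B U' V W : Univ E} {α : Arity E} {c : IRCode U' B.Ty (⊤_ E)}
  {op : ∀ {Γ : E}, α.Arg B Γ → (Γ ⟶ B.Ty)} (S : α.Constructor c op)

/-- The correspondence between the arguments of an operation and those of its constructor. -/
noncomputable def equiv (t : Univ.Hom V B) {Γ : E} (γ : Γ ⟶ ⊤_ E) : α.Arg V Γ ≃ c.Arg t.ty γ where
  toFun x := (S.existsUnique_right t γ x).choose
  invFun y := (S.existsUnique_left t y).choose
  left_inv x := (S.existsUnique_left t _).unique (S.existsUnique_left t _).choose_spec.1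
    (S.existsUnique_right t γ x).choose_spec.1
  right_inv y := (S.existsUnique_right t γ _).unique (S.existsUnique_right t γ _).choose_spec.1
    (S.existsUnique_left t y).choose_spec.1

theorem rel_equiv (t : Univ.Hom V B) {Γ : E} (γ : Γ ⟶ ⊤_ E) (x : α.Arg V Γ) :
    S.Rel t x (S.equiv t γ x) :=
  (S.existsUnique_right t γ x).choose_spec.1

theorem eq_equiv {t : Univ.Hom V B} {Γ : E} {γ : Γ ⟶ ⊤_ E} {x : α.Arg V Γ} {y : c.Arg t.ty γ}
    (h : S.Rel t x y) : y = S.equiv t γ x :=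
  (S.existsUnique_right t γ x).unique h (S.rel_equiv t γ x)

theorem subst_equiv (t : Univ.Hom V B) {Γ Δ : E} (τ : Δ ⟶ Γ) (γ : Γ ⟶ ⊤_ E) (x : α.Arg V Γ) :
    c.subst t.ty τ (S.equiv t γ x) = S.equiv t (τ ≫ γ) (α.subst τ x) :=
  S.eq_equiv (S.rel_subst t τ (S.rel_equiv t γ x))

theorem map_equiv {t : Univ.Hom V B} {f : Univ.Hom V W} {t' : Univ.Hom W B} (w : f.comp t' = t)
    (hf : f.ty ≫ t'.ty = t.ty) {Γ : E} (γ : Γ ⟶ ⊤_ E) (x : α.Arg V Γ) :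
    c.map f.ty hf (S.equiv t γ x) = S.equiv t' γ (α.map f x) := by
  subst w
  exact S.eq_equiv (S.rel_map f t' (S.rel_equiv _ γ x))

theorem val_equiv (t : Univ.Hom V B) {Γ : E} (γ : Γ ⟶ ⊤_ E) (x : α.Arg V Γ) :
    c.val t.ty (S.equiv t γ x) = op (α.map t x) :=
  S.val_eq t (S.rel_equiv t γ x)

end Arity.Constructor

namespace CodedUniv

variable {ι : Type} {σ : ι → Arity E} {B C : CodedUniv σ} {U' : Univ E}
  {cs : List (IRCode U' B.U.Ty (⊤_ E))} {φ : ι ≃ Fin cs.length}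
  (S : ∀ o, (σ o).Constructor (cs.get (φ o)) (B.op o))

/-- A universe over `B` with the operations of `B` interprets the inductive-recursive definition
whose constructors introduce these operations. -/
noncomputable def toIRAlg {k : Univ.Hom C.U B.U} (hk : IsHom C B k) : IRAlg cs where
  X := C.U.Ty
  T := k.ty
  intro n {Δ γ} := Equiv.piCongrLeft
    (fun n => ∀ (Δ : E) (γ : Δ ⟶ ⊤_ E), (cs.get n).Arg k.ty γ → (Δ ⟶ C.U.Ty)) φ
    (fun o _ γ y => C.op o (((S o).equiv k γ).symm y)) n Δ γ
  intro_subst n {Δ Δ'} τ γ y := by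
    obtain ⟨o, rfl⟩ := φ.surjective n
    obtain ⟨x, rfl⟩ := ((S o).equiv k γ).surjective y
    simp only [Equiv.piCongrLeft_apply_apply, (S o).subst_equiv, Equiv.symm_apply_apply, C.op_subst]
  intro_T n {Δ γ} y := by
    obtain ⟨o, rfl⟩ := φ.surjective n
    obtain ⟨x, rfl⟩ := ((S o).equiv k γ).surjective y
    simp only [Equiv.piCongrLeft_apply_apply, (S o).val_equiv, Equiv.symm_apply_apply, hk o x]

theorem toIRAlg_intro_equiv {k : Univ.Hom C.U B.U} (hk : IsHom C B k) (o : ι) {Γ : E}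
    (γ : Γ ⟶ ⊤_ E) (x : (σ o).Arg C.U Γ) :
    (toIRAlg S hk).intro (φ o) ((S o).equiv k γ x) = C.op o x := by
  simp only [toIRAlg, Equiv.piCongrLeft_apply_apply, Equiv.symm_apply_apply]

/-- The universe over `B` that is defined by induction-recursion. -/
noncomputable def ofIRAlg (A : IRAlg cs) : CodedUniv σ where
  U := B.U.restrict A.T
  op o Γ x := A.intro (φ o) ((S o).equiv (B.U.restrictHom A.T) (terminal.from Γ) x)
  op_subst o Γ Δ τ x := by
    rw [← terminal.comp_from τ, ← (S o).subst_equiv]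
    exact A.intro_subst _ _ _

theorem isHom_ofIRAlg (A : IRAlg cs) : IsHom (ofIRAlg S A) B (B.U.restrictHom A.T) :=
  fun o _ x => (A.intro_T (φ o) _).trans ((S o).val_equiv (B.U.restrictHom A.T) _ x)

theorem isHom_ofIRAlg_iff (A : IRAlg cs) {k : Univ.Hom C.U B.U} (hk : IsHom C B k)
    {s : Univ.Hom (ofIRAlg S A).U C.U} (w : s.comp k = B.U.restrictHom A.T) :
    IsHom (ofIRAlg S A) C s ↔
      ∀ (n : Fin cs.length) {Δ : E} {γ : Δ ⟶ ⊤_ E} (y : (cs.get n).Arg A.T γ),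
        A.intro n y ≫ s.ty =
          (toIRAlg S hk).intro n ((cs.get n).map s.ty (congrArg Univ.Hom.ty w) y) := by
  have intro_map (o : ι) {Γ : E} (x : (σ o).Arg (B.U.restrict A.T) Γ) :
      (toIRAlg S hk).intro (φ o) ((cs.get (φ o)).map s.ty (congrArg Univ.Hom.ty w)
        ((S o).equiv (B.U.restrictHom A.T) (terminal.from Γ) x)) = C.op o ((σ o).map s x) :=
    (congrArg ((toIRAlg S hk).intro (φ o))
      ((S o).map_equiv w (congrArg Univ.Hom.ty w) (terminal.from Γ) x)).trans
        (toIRAlg_intro_equiv S hk o _ _)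
  constructor
  · intro hs n Δ γ y
    obtain ⟨o, rfl⟩ := φ.surjective n
    obtain rfl : γ = terminal.from Δ := Subsingleton.elim _ _
    obtain ⟨x, rfl⟩ := ((S o).equiv (B.U.restrictHom A.T) _).surjective y
    exact (hs o x).trans (intro_map o x).symm
  · intro hs o Γ x
    exact (hs (φ o) _).trans (intro_map o x)

theorem isInductive_ofIRAlg {A : IRAlg cs} (hA : A.IsInitial) : (ofIRAlg S A).IsInductive := by
  refine isInductive_of_existsUnique_hom (isHom_ofIRAlg S A) fun C k hk => ?_
  obtain ⟨f, ⟨w, hf⟩, f_unique⟩ := hA (toIRAlg S hk)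
  let s : Univ.Hom (ofIRAlg S A).U C.U := (B.U.restrictHom A.T).ofTy k f w
  have hs : s.comp k = B.U.restrictHom A.T := Univ.Hom.ofTy_comp _ _ _ _
  refine ⟨s, ⟨(isHom_ofIRAlg_iff S A hk hs).2 hf, hs⟩, ?_⟩
  rintro s' ⟨hs', w'⟩
  exact Univ.Hom.ext_of_comp k (w'.trans hs.symm)
    (f_unique _ ⟨congrArg Univ.Hom.ty w', (isHom_ofIRAlg_iff S A hk w').1 hs'⟩)

theorem exists_isInductive [Finite ι] (hIR : U'.SupportsIR B.U.Ty)
    (hB : ∀ o, ∃ c : IRCode U' B.U.Ty (⊤_ E), Nonempty ((σ o).Constructor c (B.op o))) :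
    ∃ (A : CodedUniv σ) (t : Univ.Hom A.U B.U),
      A.IsInductive ∧ IsHom A B t ∧ U'.Small (terminal.from A.U.Ty) := by
  choose c hc using hB
  obtain ⟨cs, φ, rfl⟩ := exists_list_get_comp_equiv c
  let S (o : ι) := (hc o).some
  obtain ⟨A, hA, hsmall⟩ := hIR cs
  exact ⟨ofIRAlg S A, _, isInductive_ofIRAlg S hA, isHom_ofIRAlg S A, hsmall⟩

end CodedUniv

end InitialUniverses

section Hierarchies

/-- The names of the operations on the codes of the universes `V i`: `up m` includes the universe
`U m`, and `uni k` is the code of `V k`. -/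
inductive CodeOp
  | pi
  | sigma
  | eq
  | unit
  | bool
  | up (m : ℕ)
  | uni (k : ℕ)

namespace CodeOp

/-- The operations that the universe `V i` has. -/
def stage (i : ℕ) : Set CodeOp :=
  {o | match o with
    | up m => m ≤ i
    | uni k => k < i
    | _ => True}

theorem stage_mono {i j : ℕ} (h : i ≤ j) : stage i ⊆ stage j
  | pi, _ | sigma, _ | eq, _ | unit, _ | bool, _ => trivial
  | up _, hm => le_trans hm h
  | uni _, hk => lt_of_lt_of_le hk h

instance (i : ℕ) : Finite (stage i) := by
  refine Set.Finite.subset (s := {pi, sigma, eq, unit, bool} ∪ up '' Set.Iic i ∪ uni '' Set.Iio i)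
    (((Set.toFinite _).union ((Set.finite_Iic i).image _)).union ((Set.finite_Iio i).image _)) ?_
  rintro (_ | _ | _ | _ | _ | m | k) ho
  case up => exact .inl (.inr ⟨m, ho, rfl⟩)
  case uni => exact .inr ⟨k, ho, rfl⟩
  all_goals simp

end CodeOp

variable {E : Type u} [Category.{v} E] [HasFiniteLimits E] [HasFiniteCoproducts E] [LCCC E]

namespace WeakHierarchy

variable (W : WeakHierarchy E) {i : ℕ}

/-- The arities of the operations of the universe `V i`. -/
noncomputable def arity (i : ℕ) (o : CodeOp.stage i) : Arity E :=
  match o.1 with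
  | .pi | .sigma => .fam
  | .eq => .pair
  | .unit | .bool | .uni _ => .const (⊤_ E)
  | .up m => .const (W.U m).Ty

theorem isRepresentable_arity (o : CodeOp.stage i) (V : Univ E) :
    (W.arity i o).IsRepresentable V :=
  match o with
  | ⟨.pi, _⟩ | ⟨.sigma, _⟩ => Arity.isRepresentable_fam V
  | ⟨.eq, _⟩ => Arity.isRepresentable_pair V
  | ⟨.unit, _⟩ | ⟨.bool, _⟩ | ⟨.uni _, _⟩ | ⟨.up _, _⟩ => Arity.isRepresentable_const _ V

variable {U U' : Univ E}

/-- The operations of the universe `V i` on a universe with codes, for given values of `up`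
and `uni`. -/
noncomputable def codedUniv (c : U.Codes) (up : ∀ m ≤ i, (W.U m).Ty ⟶ U.Ty)
    (uni : ∀ k < i, ⊤_ E ⟶ U.Ty) : CodedUniv (W.arity i) where
  U := U
  op o Γ := match o with
    | ⟨.pi, _⟩ => c.pi
    | ⟨.sigma, _⟩ => c.sigma
    | ⟨.eq, _⟩ => c.eq
    | ⟨.unit, _⟩ => fun x : Γ ⟶ ⊤_ E => x ≫ c.unit
    | ⟨.bool, _⟩ => fun x : Γ ⟶ ⊤_ E => x ≫ c.bool
    | ⟨.up m, hm⟩ => fun x : Γ ⟶ (W.U m).Ty => x ≫ up m hm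
    | ⟨.uni k, hk⟩ => fun x : Γ ⟶ ⊤_ E => x ≫ uni k hk
  op_subst o _ _ τ := match o with
    | ⟨.pi, _⟩ => c.pi_subst τ
    | ⟨.sigma, _⟩ => c.sigma_subst τ
    | ⟨.eq, _⟩ => c.eq_subst τ
    | ⟨.unit, _⟩ | ⟨.bool, _⟩ | ⟨.up _, _⟩ | ⟨.uni _, _⟩ => fun _ => (Category.assoc _ _ _).symm

variable {W} {c : U.Codes} {up : ∀ m ≤ i, (W.U m).Ty ⟶ U.Ty} {uni : ∀ k < i, ⊤_ E ⟶ U.Ty}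

theorem exists_isInductive_codedUniv (h : Univ.Hom U U') (hIR : U'.SupportsIR U.Ty)
    (hunit : U'.Small (𝟙 (⊤_ E))) (hlevel : ∀ m ≤ i, U'.Small (terminal.from (W.U m).Ty)) :
    ∃ (A : CodedUniv (W.arity i)) (t : Univ.Hom A.U U), A.IsInductive ∧
      CodedUniv.IsHom A (W.codedUniv c up uni) t ∧ U'.Small (terminal.from A.U.Ty) := by
  have hterminal : U'.Small (terminal.from (⊤_ E)) := by
    rwa [Subsingleton.elim (terminal.from (⊤_ E)) (𝟙 _)]
  refine CodedUniv.exists_isInductive (B := W.codedUniv c up uni) hIR fun o => ?_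
  have op_subst {Γ Δ : E} (τ : Δ ⟶ Γ) := (W.codedUniv c up uni).op_subst o τ
  match o with
  | ⟨.pi, _⟩ | ⟨.sigma, _⟩ => exact Arity.exists_constructor_fam h hunit op_subst
  | ⟨.eq, _⟩ => exact Arity.exists_constructor_pair h hunit op_subst
  | ⟨.unit, _⟩ | ⟨.bool, _⟩ | ⟨.uni _, _⟩ =>
    exact Arity.exists_constructor_const hterminal op_subst
  | ⟨.up m, hm⟩ => exact Arity.exists_constructor_const (hlevel m hm) op_subst

theorem decodesAlike_codedUniv (hc : c.IsWeak) {c' : U'.Codes} (hc' : c'.IsWeak)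
    {up' : ∀ m ≤ i, (W.U m).Ty ⟶ U'.Ty} {uni' : ∀ k < i, ⊤_ E ⟶ U'.Ty}
    (hup : ∀ m hm, U'.Decodes (up' m hm) (U.proj (up m hm)))
    (huni : ∀ k hk, U'.Decodes (uni' k hk) (U.proj (uni k hk))) (o : CodeOp.stage i) :
    CodedUniv.DecodesAlike (W.codedUniv c up uni) (W.codedUniv c' up' uni') o := by
  intro V f g Γ x
  match o with
  | ⟨.pi, _⟩ => exact (hc.decodes_pi_fam f x).proj (hc'.decodes_pi_fam g x)
  | ⟨.sigma, _⟩ => exact (hc.decodes_sigma_fam f x).proj (hc'.decodes_sigma_fam g x)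
  | ⟨.eq, _⟩ => exact (hc.decodes_eq_pair f x).proj (hc'.decodes_eq_pair g x)
  | ⟨.unit, _⟩ => exact (hc.unit.proj hc'.unit).subst (Univ.isPullback_extMap x rfl)
  | ⟨.bool, _⟩ => exact (hc.bool.proj hc'.bool).subst (Univ.isPullback_extMap x rfl)
  | ⟨.up m, hm⟩ => exact (hup m hm).subst (Univ.isPullback_extMap x rfl)
  | ⟨.uni k, hk⟩ => exact (huni k hk).subst (Univ.isPullback_extMap x rfl)

/-- The codes among the operations of the universe `V i`. -/
noncomputable def codesOf (A : CodedUniv (W.arity i)) : A.U.Codes where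
  pi := A.op ⟨.pi, trivial⟩
  sigma := A.op ⟨.sigma, trivial⟩
  eq := A.op ⟨.eq, trivial⟩
  unit := A.op ⟨.unit, trivial⟩ (𝟙 (⊤_ E))
  bool := A.op ⟨.bool, trivial⟩ (𝟙 (⊤_ E))
  pi_subst := A.op_subst ⟨.pi, trivial⟩
  sigma_subst := A.op_subst ⟨.sigma, trivial⟩
  eq_subst := A.op_subst ⟨.eq, trivial⟩

theorem isStrict_codesOf {A B : CodedUniv (W.arity i)} {f : Univ.Hom A.U B.U}
    (hf : CodedUniv.IsHom A B f) : f.IsStrict (codesOf A) (codesOf B) where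
  pi := hf ⟨.pi, trivial⟩
  sigma := hf ⟨.sigma, trivial⟩
  eq := hf ⟨.eq, trivial⟩
  unit := hf ⟨.unit, trivial⟩ _
  bool := hf ⟨.bool, trivial⟩ _

theorem codesOf_codedUniv : codesOf (W.codedUniv c up uni) = c := by
  cases c
  simp only [codesOf, codedUniv, Category.id_comp]

theorem isInjective_codesOf {A : CodedUniv (W.arity i)} (hA : A.IsInductive)
    (x : ⊤_ E ⟶ A.U.El) : (codesOf A).IsInjective where
  pi := hA.op_injective (W.isRepresentable_arity ⟨.pi, trivial⟩ _)
    (⟨x ≫ A.U.p, terminal.from _ ≫ x ≫ A.U.p⟩ : A.U.Fam (⊤_ E))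
  sigma := hA.op_injective (W.isRepresentable_arity ⟨.sigma, trivial⟩ _)
    (⟨x ≫ A.U.p, terminal.from _ ≫ x ≫ A.U.p⟩ : A.U.Fam (⊤_ E))
  eq := hA.op_injective (W.isRepresentable_arity ⟨.eq, trivial⟩ _)
    (⟨x, x, rfl⟩ : A.U.Pair (⊤_ E))

end WeakHierarchy

end Hierarchies

section Towers

variable {E : Type u} [Category.{v} E] [HasFiniteLimits E] [HasFiniteCoproducts E] [LCCC E]
  {W : WeakHierarchy E}

namespace WeakHierarchy

variable (W) in
/-- The top universe with the operations of the universe `V i`, where `self k` is the code of the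
type `V k`. -/
noncomputable abbrev top (i : ℕ) (self : ∀ k < i, ⊤_ E ⟶ (W.U ⊤).Ty) : CodedUniv (W.arity i) :=
  W.codedUniv (W.codes ⊤) (fun m _ => (W.lift (WithTop.coe_lt_top m)).ty) self

variable (W) in
theorem exists_decodes_lift {i m : ℕ} (hm : m ≤ i) : ∃ a : (W.U m).Ty ⟶ (W.U i).Ty,
    (W.U i).Decodes a ((W.U ⊤).proj (W.lift (WithTop.coe_lt_top m)).ty) := by
  have level_small : (W.U i).Small (W.U m).p := by
    obtain rfl | hlt := hm.eq_or_lt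
    · exact ⟨_, _, (Univ.Hom.id _).isPullback⟩
    · exact ⟨_, _, (W.lift (WithTop.coe_lt_coe.2 hlt)).isPullback⟩
  exact level_small.imp fun _ => Univ.Decodes.proj ⟨_, (W.lift _).isPullback⟩

variable (W) in
/-- Universes `V 0 : V 1 : …` over the top universe of which `V i` is freely generated by the
operations of the stage `i`. -/
structure Tower where
  V : ∀ i, CodedUniv (W.arity i)
  isInductive : ∀ i, (V i).IsInductive
  self : ℕ → (⊤_ E ⟶ (W.U ⊤).Ty)
  self_decodes : ∀ i, (W.U ⊤).Decodes (self i) (terminal.from (V i).U.Ty)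
  dec : ∀ i, Univ.Hom (V i).U (W.U ⊤)
  isHom_dec : ∀ i, CodedUniv.IsHom (V i) (W.top i fun k _ => self k) (dec i)

theorem nonempty_tower (hIR : (W.U ⊤).SupportsLargeIR) : Nonempty W.Tower := by
  choose V dec isInductive isHom_dec code code_decodes using
    fun (i : ℕ) (self : ∀ k < i, ⊤_ E ⟶ (W.U ⊤).Ty) =>
      exists_isInductive_codedUniv (c := W.codes ⊤)
        (up := fun m _ => (W.lift (WithTop.coe_lt_top m)).ty) (uni := self) (Univ.Hom.id (W.U ⊤))
        (hIR _) ⟨_, (W.isWeak ⊤).unit⟩ fun m _ => W.small (WithTop.coe_lt_top m)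
  let self : ℕ → (⊤_ E ⟶ (W.U ⊤).Ty) := wellFounded_lt.fix code
  have self_eq (i : ℕ) : self i = code i fun k _ => self k := wellFounded_lt.fix_eq code i
  exact ⟨{
    V i := V i fun k _ => self k
    isInductive _ := isInductive _ _
    self
    self_decodes i := self_eq i ▸ code_decodes i _
    dec i := dec i fun k _ => self k
    isHom_dec _ := isHom_dec _ _ }⟩

namespace Tower

variable (T : W.Tower) {i j k : ℕ}

/-- The universe `V j` with the operations of an earlier stage only. -/
noncomputable abbrev restrict (h : i ≤ j) : CodedUniv (W.arity i) :=
  (T.V j).reindex (Set.inclusion (CodeOp.stage_mono h))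

theorem isHom_dec_restrict (h : i ≤ j) :
    CodedUniv.IsHom (T.restrict h) (W.top i fun k _ => T.self k) (T.dec j) := by
  rintro ⟨o, ho⟩
  cases o <;> exact T.isHom_dec j ⟨_, CodeOp.stage_mono h ho⟩

theorem isStrict_dec (i : ℕ) : (T.dec i).IsStrict (codesOf (T.V i)) (W.codes ⊤) := by
  have h := isStrict_codesOf (T.isHom_dec i)
  rwa [codesOf_codedUniv] at h

theorem isInjective_codesOf (i : ℕ) : (codesOf (T.V i)).IsInjective := by
  have unit_decodes : (T.V i).U.Decodes (codesOf (T.V i)).unit (𝟙 (⊤_ E)) := by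
    rw [← (T.dec i).decodes_iff, (T.isStrict_dec i).unit]
    exact (W.isWeak ⊤).unit
  exact WeakHierarchy.isInjective_codesOf (T.isInductive i) unit_decodes.choose

theorem existsUnique_lift (h : i ≤ j) : ∃! f : Univ.Hom (T.V i).U (T.V j).U,
    CodedUniv.IsHom (T.V i) (T.restrict h) f ∧ f.comp (T.dec j) = T.dec i :=
  (T.isInductive i).existsUnique_lift (T.isHom_dec i) (T.isHom_dec_restrict h)

/-- The lift `V i → V j`. -/
noncomputable def lift (h : i ≤ j) : Univ.Hom (T.V i).U (T.V j).U :=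
  (T.existsUnique_lift h).choose

theorem isHom_lift (h : i ≤ j) : CodedUniv.IsHom (T.V i) (T.restrict h) (T.lift h) :=
  (T.existsUnique_lift h).choose_spec.1.1

theorem lift_comp_dec (h : i ≤ j) : (T.lift h).comp (T.dec j) = T.dec i :=
  (T.existsUnique_lift h).choose_spec.1.2

theorem lift_refl (i : ℕ) : T.lift (le_refl i) = Univ.Hom.id _ :=
  (T.existsUnique_lift le_rfl).unique ⟨T.isHom_lift _, T.lift_comp_dec _⟩
    ⟨CodedUniv.IsHom.id _, Univ.Hom.id_comp _⟩

theorem lift_trans (h : i ≤ j) (h' : j ≤ k) :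
    (T.lift h).comp (T.lift h') = T.lift (h.trans h') := by
  refine (T.existsUnique_lift (h.trans h')).unique ⟨(T.isHom_lift h).comp ?_, ?_⟩
    ⟨T.isHom_lift _, T.lift_comp_dec _⟩
  · exact fun o => T.isHom_lift h' (Set.inclusion (CodeOp.stage_mono h) o)
  · rw [Univ.Hom.comp_assoc, T.lift_comp_dec, T.lift_comp_dec]

/-- The inclusion `U i → V i`. -/
noncomputable def up (i : ℕ) : Univ.Hom (W.U i) (T.V i).U :=
  (W.lift (WithTop.coe_lt_top i)).ofTy (T.dec i)
    ((T.V i).op ⟨.up i, le_refl i⟩ (𝟙 (W.U i).Ty))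
    ((T.isHom_dec i ⟨.up i, le_refl i⟩ (𝟙 (W.U i).Ty)).trans (Category.id_comp _))

/-- The code of `V k` in `V i`. -/
noncomputable def uni (h : k < i) : ⊤_ E ⟶ (T.V i).U.Ty :=
  (T.V i).op ⟨.uni k, h⟩ (𝟙 (⊤_ E))

/-- The strictly cumulative hierarchy that a tower forms. -/
noncomputable def toStrictHierarchy : StrictHierarchy W where
  V i := (T.V i).U
  dec := T.dec
  codes i := codesOf (T.V i)
  injective := T.isInjective_codesOf
  dec_strict := T.isStrict_dec
  self := T.self
  self_decodes := T.self_decodes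
  uni := T.uni
  dec_uni h := (T.isHom_dec _ ⟨.uni _, h⟩ (𝟙 (⊤_ E))).trans (Category.id_comp _)
  lift := T.lift
  lift_refl := T.lift_refl
  lift_trans := T.lift_trans
  lift_dec := T.lift_comp_dec
  lift_strict h := isStrict_codesOf (T.isHom_lift h)
  lift_uni h h' := T.isHom_lift h' ⟨.uni _, h⟩ _
  up := T.up
  up_dec _ := Univ.Hom.ofTy_comp _ _ _ _

theorem exists_span (hi : ∀ k < i, (W.U i).Small (terminal.from (T.V k).U.Ty)) :
    ∃ (up : ∀ m ≤ i, (W.U m).Ty ⟶ (W.U i).Ty) (uni : ∀ k < i, ⊤_ E ⟶ (W.U i).Ty)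
      (B : CodedUniv (W.arity i)) (f : Univ.Hom B.U (W.U ⊤)) (g : Univ.Hom B.U (W.U i)),
      CodedUniv.IsHom B (W.top i fun k _ => T.self k) f ∧
        CodedUniv.IsHom B (W.codedUniv (W.codes i) up uni) g := by
  choose up up_decodes using fun (m : ℕ) (hm : m ≤ i) => W.exists_decodes_lift hm
  choose uni uni_decodes using hi
  exact ⟨up, uni, CodedUniv.exists_span W.isRepresentable_arity
    (decodesAlike_codedUniv (W.isWeak ⊤) (W.isWeak i) up_decodes
      fun k hk => (T.self_decodes k).proj (uni_decodes k hk))⟩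

theorem nonempty_hom (hi : ∀ k < i, (W.U i).Small (terminal.from (T.V k).U.Ty)) :
    Nonempty (Univ.Hom (T.V i).U (W.U i)) := by
  obtain ⟨up, uni, B, f, g, hf, -⟩ := T.exists_span hi
  obtain ⟨r, -, -⟩ := (T.isInductive i).existsUnique_lift (T.isHom_dec i) hf
  exact ⟨r.comp g⟩

theorem sameClass (hi : ∀ k < i, (W.U i).Small (terminal.from (T.V k).U.Ty)) :
    (T.V i).U.SameClass (W.U i) := by
  obtain ⟨r⟩ := T.nonempty_hom hi
  exact fun _ _ _ => ⟨r.small, (T.up i).small⟩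

theorem small_succ (hW : W.SupportsSmallIR)
    (hi : ∀ k < i, (W.U i).Small (terminal.from (T.V k).U.Ty)) :
    (W.U (i + 1 : ℕ)).Small (terminal.from (T.V i).U.Ty) := by
  obtain ⟨up, uni, B, f, g, hf, hg⟩ := T.exists_span hi
  obtain ⟨A, t, hA, ht, a, ha⟩ := exists_isInductive_codedUniv (c := W.codes i) (up := up)
    (uni := uni) (W.lift (WithTop.coe_lt_coe.2 i.lt_succ_self)) (hW i) ⟨_, (W.isWeak _).unit⟩
    fun m hm => W.small (WithTop.coe_lt_coe.2 (Nat.lt_succ_of_le hm))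
  obtain ⟨r, ⟨hr, -⟩, -⟩ := hA.existsUnique_lift ht hg
  obtain ⟨e⟩ := (T.isInductive i).nonempty_iso hA (T.isHom_dec i) (hr.comp hf)
  exact ⟨a, ha.of_iso e (Subsingleton.elim _ _)⟩

theorem small (hW : W.SupportsSmallIR) (h : k < i) :
    (W.U i).Small (terminal.from (T.V k).U.Ty) := by
  induction k using Nat.strong_induction_on generalizing i with
  | _ k ih =>
    have hk := T.small_succ hW fun m hm => ih m hm hm
    obtain rfl | hlt := (Nat.succ_le_of_lt h).eq_or_lt
    · exact hk
    · exact (W.lift (WithTop.coe_lt_coe.2 hlt)).small hk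

end Tower

end WeakHierarchy

end Towers

end TarskiUniverse

theorem mainTheorem4 {E : Type u} [Category.{v} E] [HasFiniteLimits E] [HasFiniteCoproducts E]
    [TarskiUniverse.LCCC E] (W : TarskiUniverse.WeakHierarchy E)
    (hIR : (W.U ⊤).SupportsLargeIR) :
    ∃ H : TarskiUniverse.StrictHierarchy W,
      (∀ i : ℕ, (∀ k < i, (W.U (i : WithTop ℕ)).Small (terminal.from (H.V k).Ty)) →
        (H.V i).SameClass (W.U (i : WithTop ℕ))) ∧
      (W.SupportsSmallIR → ∀ i : ℕ, (H.V i).SameClass (W.U (i : WithTop ℕ))) := by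
  obtain ⟨T⟩ := TarskiUniverse.WeakHierarchy.nonempty_tower hIR
  exact ⟨T.toStrictHierarchy, fun _ hi => T.sameClass hi,
    fun hW _ => T.sameClass fun _ hk => T.small hW hk⟩
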